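/- **Setting.** Let $T$ be a complete (one-sorted, classical) first-order NIP theory, and let $\mathfrak C\models T$ be a monster model: for some strong limit cardinal $\kappa>|T|$ (where $|T|=\max(\aleph_0,|L|)$), $\mathfrak C$ is $\kappa$-saturated and strongly $\kappa$-homogeneous. "Small" means of cardinality $<\kappa$; all index sets and lengths of tuples below are small. Let $E$ be a $\emptyset$-type-definable equivalence relation on $\mathfrak C^\lambda$, $\lambda$ small. The classes $a/E$ are called hyperimaginaries, and two finite tuples of hyperimaginaries have the same type (over $\emptyset$) if they are conjugate under $\mathrm{Aut}(\mathfrak C)$. A sequence $(c_i)_{i\in\mathcal I}$ of tuples of elements of $\mathfrak C$, or of hyperimaginaries of $\mathfrak C^\lambda/E$, indexed by a linear order $\mathcal I$ is *indiscernible* if $c_{i_1}\dots c_{i_n}$ and $c_{j_1}\dots c_{j_n}$ have the same type whenever $n<\omega$, $i_1<\dots<i_n$ and $j_1<\dots<j_n$. It is *dense* if $\mathcal I$ is a dense linear order. A *cut* of the sequence $I$ is a decomposition $I=I_1+I_2$ as a concatenation; it is *Dedekind* if $I_1$ and the reverse of $I_2$ have infinite cofinality; $b$ *fills* it if $I_1+b+I_2$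 is indiscernible. A dense indiscernible sequence $I$ is *distal* if for any two distinct Dedekind cuts, dividing $I=I_1+I_2+I_3$ (so that the cuts are $(I_1,I_2+I_3)$ and $(I_1+I_2,I_3)$), whenever $b$ fills the first cut and $d$ fills the second, the sequence $I_1+b+I_2+d+I_3$ is indiscernible. (For sequences of hyperimaginaries of $\mathfrak C^\lambda/E$, the fillers $b,d$ range over $\mathfrak C^\lambda/E$.) The theory $T$ is *distal* if all dense indiscernible sequences of tuples of elements of $\mathfrak C$ are distal, and $T^{\mathrm{heq}}$ is *distal* if all dense indiscernible sequences of hyperimaginaries $(a_i/E)_{i\in\mathcal I}$ are distal, for all $\emptyset$-type-definable equivalence relations $E$ on $\mathfrak C^\lambda$ and all small $\lambda$. **Theorem.** If $(a_i)_{i\in\mathcal I}$ is a dense distal indiscernible sequence of tuples from $\mathfrak C^\lambda$, then $(a_i/E)_{i\in\mathcal I}$ is a distal sequence of hyperimaginaries, for every $\emptyset$-type-definable equivalence relation $E$ on $\mathfrak C^\lambda$. Consequently, if $T$ is distal, then $T^{\mathrm{heq}}$ is distal. -/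

import Mathlib

open scoped FirstOrder Cardinal
open FirstOrder

universe u v w w'

namespace ModelTheory

/-! ### Monster models -/

section Monster

variable (L : FirstOrder.Language.{u, v}) (M : Type w) [L.Structure M]

/-- `M` is `κ`-saturated: for every `A ⊆ M` with `|A| < κ`, every (partial) type over `A`, in a
possibly infinite tuple of fewer than `κ` variables, is realized in `M`. A partial type over `A` is
a set of formulas over `A` that is finitely satisfiable in `M`, i.e. consistent with the
elementary diagram of `M`. -/
def IsSaturated (κ : Cardinal.{w}) : Prop :=
  ∀ (A : Set M), #A < κ → ∀ (α : Type w), #α < κ → ∀ p : Set (L[[A]].Formula α),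
    (∀ p₀ : Finset (L[[A]].Formula α), (p₀ : Set (L[[A]].Formula α)) ⊆ p →
      ∃ c : α → M, ∀ φ ∈ p₀, φ.Realize c) →
    ∃ c : α → M, ∀ φ ∈ p, φ.Realize c

/-- `M` is strongly `κ`-homogeneous: every elementary map `f` from a set `A ⊆ M` with `|A| < κ`
into `M` extends to an automorphism of `M`. -/
def IsStronglyHomogeneous (κ : Cardinal.{w}) : Prop :=
  ∀ (A : Set M), #A < κ → ∀ f : A → M,
    (∀ φ : L.Formula A, φ.Realize (fun x : A => (x : M)) ↔ φ.Realize f) →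
    ∃ σ : M ≃[L] M, ∀ x : A, σ x = f x

/-- `M` is a monster model with degree of saturation `κ`, where `κ` is a strong limit cardinal
larger than the cardinality `max ℵ₀ |L|` of the theory. -/
structure IsMonster (κ : Cardinal.{w}) : Prop where
  isStrongLimit : κ.IsStrongLimit
  aleph0_lt : ℵ₀ < κ
  card_lt : Cardinal.lift.{w} L.card < Cardinal.lift.{max u v} κ
  isSaturated : IsSaturated L M κ
  isStronglyHomogeneous : IsStronglyHomogeneous L M κ

end Monster

/-! ### Indiscernible sequences, cuts and distality

These notions make sense for sequences in any set `X` on which one knows when two `n`-tuples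
have the same type over `∅`. They are applied to tuples of elements of the monster model and to
hyperimaginaries. -/

section Sequences

variable {X : Type w'} (S : ∀ n : ℕ, (Fin n → X) → (Fin n → X) → Prop)

/-- `(a_i)_{i ∈ I}` is indiscernible: for all `i₁ < ⋯ < iₙ` and `j₁ < ⋯ < jₙ` in `I`, the tuples
`a_{i₁} … a_{iₙ}` and `a_{j₁} … a_{jₙ}` have the same type. -/
def IsIndiscernible {I : Type w} [LinearOrder I] (a : I → X) : Prop :=
  ∀ (n : ℕ) (i j : Fin n → I), StrictMono i → StrictMono j →
    S n (fun k => a (i k)) (fun k => a (j k))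

/-- The concatenation `a + b` of two sequences. -/
def concat {I J : Type w} (a : I → X) (b : J → X) : I ⊕ₗ J → X :=
  fun x => Sum.elim a b (ofLex x)

/-- The one-term sequence with term `b`. -/
def single (b : X) : PUnit.{w + 1} → X := fun _ => b

/-- The restriction of a sequence to a set of indices. -/
def part {I : Type w} (a : I → X) (P : Set I) : P → X := fun i => a i

section Cuts

variable {I : Type w} [LinearOrder I]

/-- A cut `(I₁, I₂)` of a sequence indexed by `I` is given by its left part, an initial segment
`C` of `I`; the right part is indexed by the complement of `C`. The cut is Dedekind if both its
left part and its reversed right part have infinite cofinality. -/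
def IsDedekind (C : LowerSet I) : Prop :=
  ℵ₀ ≤ Order.cof (C : Set I) ∧ ℵ₀ ≤ Order.cof (((C : Set I)ᶜ : Set I))ᵒᵈ

/-- `b` fills the cut `C = (I₁, I₂)` of the sequence `a`: the sequence `I₁ + b + I₂` is
indiscernible. -/
def Fills (a : I → X) (C : LowerSet I) (b : X) : Prop :=
  IsIndiscernible S
    (concat (concat (part a (C : Set I)) (single.{w} b)) (part a (C : Set I)ᶜ))

/-- The (dense) sequence `a` is distal: it is indiscernible and, for any distinct Dedekind cuts,
which are called `C < D` so that `C` is to the left of `D`, if `b` fills `C` and `d` fills `D`, then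
`I₁ + b + I₂ + d + I₃` is indiscernible, where `I₁, I₂, I₃` are the three pieces into which the two
cuts divide the sequence. -/
def IsDistalSeq (a : I → X) : Prop :=
  IsIndiscernible S a ∧
    ∀ C D : LowerSet I, IsDedekind C → IsDedekind D → C < D →
      ∀ b d : X, Fills S a C b → Fills S a D d →
        IsIndiscernible S
          (concat (concat (concat (concat
            (part a (C : Set I)) (single.{w} b))
            (part a ((D : Set I) \ (C : Set I)))) (single.{w} d))
            (part a (D : Set I)ᶜ))

end Cuts

end Sequences

/-! ### Types of tuples and of hyperimaginaries -/

section Types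

variable (L : FirstOrder.Language.{u, v}) {M : Type w} [L.Structure M]

/-- Two `n`-tuples of `ι`-tuples of elements of `M` have the same type over `∅`: they satisfy the
same formulas. -/
def SameType {ι : Type w'} (n : ℕ) (x y : Fin n → ι → M) : Prop :=
  ∀ φ : L.Formula (Fin n × ι),
    φ.Realize (fun p => x p.1 p.2) ↔ φ.Realize (fun p => y p.1 p.2)

variable (M)

/-- A `∅`-type-definable equivalence relation on `M^ι`: the set of pairs of equivalent `ι`-tuples is
the set of realizations in `M` of a set of formulas without parameters. -/
structure TypeDefEquiv (ι : Type w') where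
  toSetoid : Setoid (ι → M)
  typeDefinable : ∃ Φ : Set (L.Formula (ι ⊕ ι)), ∀ x y : ι → M,
    toSetoid x y ↔ ∀ φ ∈ Φ, φ.Realize (Sum.elim x y)

variable {L M}

namespace TypeDefEquiv

variable {ι : Type w'} (E : TypeDefEquiv L M ι)

/-- The hyperimaginary sort `M^ι / E`. -/
def Hyperimaginary : Type (max w' w) := Quotient E.toSetoid

/-- The hyperimaginary `a / E`. -/
def cls (a : ι → M) : E.Hyperimaginary := Quotient.mk E.toSetoid a

theorem rel_comp (σ : M ≃[L] M) {x y : ι → M} (h : E.toSetoid x y) :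
    E.toSetoid (σ ∘ x) (σ ∘ y) := by
  obtain ⟨Φ, hΦ⟩ := E.typeDefinable
  rw [hΦ] at h ⊢
  intro φ hφ
  rw [← Sum.comp_elim]
  exact (FirstOrder.Language.StrongHomClass.realize_formula σ φ).2 (h φ hφ)

/-- The action of automorphisms of `M` on hyperimaginaries: `σ (a / E) = σ(a) / E`. -/
def act (σ : M ≃[L] M) : E.Hyperimaginary → E.Hyperimaginary :=
  Quotient.map (fun x => σ ∘ x) (fun _ _ h => E.rel_comp σ h)

/-- Two `n`-tuples of hyperimaginaries have the same type over `∅`: they lie in the same orbit of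
the automorphism group of the monster model. -/
def SameType (n : ℕ) (x y : Fin n → E.Hyperimaginary) : Prop :=
  ∃ σ : M ≃[L] M, ∀ k, E.act σ (x k) = y k

end TypeDefEquiv

end Types

/-! ### Properties of the theory, evaluated in the monster model -/

section Theories

variable (L : FirstOrder.Language.{u, v}) (M : Type w) [L.Structure M]

/-- NIP: there are no formula `φ(x, y)`, indiscernible sequence `(a_i)_{i < ω}` and tuple `b` such
that `φ(a_i, b)` holds exactly for even `i`. -/
def IsNIP : Prop :=
  ∀ (m n : ℕ) (φ : L.Formula (Fin m ⊕ Fin n)), ¬ ∃ (a : ℕ → Fin m → M) (b : Fin n → M),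
    IsIndiscernible (SameType L) a ∧ ∀ i, φ.Realize (Sum.elim (a i) b) ↔ Even i

/-- The theory is distal: every (small) dense indiscernible sequence of (small) tuples is distal. -/
def IsDistal (κ : Cardinal.{w}) : Prop :=
  ∀ (ι : Type w), #ι < κ → ∀ (I : Type w) [LinearOrder I] [DenselyOrdered I], #I < κ →
    ∀ a : I → ι → M, IsIndiscernible (SameType L) a → IsDistalSeq (SameType L) a

/-- `T^heq` is distal: every (small) dense indiscernible sequence of hyperimaginaries, in the
quotient of a (small) power of the monster model by a `∅`-type-definable equivalence relation,
is distal. -/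
def IsHeqDistal (κ : Cardinal.{w}) : Prop :=
  ∀ (ι : Type w), #ι < κ → ∀ (E : TypeDefEquiv L M ι),
    ∀ (I : Type w) [LinearOrder I] [DenselyOrdered I], #I < κ →
      ∀ a : I → E.Hyperimaginary, IsIndiscernible E.SameType a → IsDistalSeq E.SameType a

end Theories

end ModelTheory

/-!
A sequence of hyperimaginaries `(a_i / E)` inherits distality from `(a_i)` by a form of Simon's
strong base change for NIP theories. Let `b / E` and `d / E` fill two distinct Dedekind cuts
`C < D` of `(a_i / E)`. It suffices to find one indiscernible sequence of representatives
`a'_i` of `a_i / E`, conjugate to `(a_i)`, together with representatives `b'` and `d'` that fill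
`C` and `D` in `(a'_i)` (`TypeDefEquiv.exists_fillsLike`): distality then makes the sequence of
tuples `I₁ + b' + I₂ + d' + I₃` indiscernible, and its image modulo `E` is the required sequence.
The difficulty is that `b / E` and `d / E` are only known to have such representatives separately.

By saturation it is enough to treat finitely many formulas
(`TypeDefEquiv.exists_equiv_mem_of_fills`). They amount to sets `U₁` and `U₂`, definable over the
sequence, that contain all terms `a_k` close to `C` and to `D` respectively, and one looks for a
conjugate of `(b / E, d / E)` over finitely many `a_i / E` whose members approximately meet `U₁` and
`U₂`. If there is none, every such conjugate has a member that stays away from `U₁` or from `U₂`.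
Since `b / E` and `d / E` fill the cuts, the cuts can be moved along `(a_i / E)` and copies of
`b / E` or `d / E` that stay away from `U₁` or `U₂` can be inserted one after the other between given
terms `a_k` (`TypeDefEquiv.exists_conjOn_of_forall_bad`). Only the offending member of each pair is
inserted, so the sequence remains a copy of a part of `(a_i / E)`. Sufficiently many insertions give
automorphic copies of `(a_i)` along which a definable set alternates arbitrarily often, which is
impossible in an NIP theory (`IsNIP.exists_forall_not_alternating`).

For the second assertion, every infinite indiscernible sequence of hyperimaginaries has an
indiscernible sequence of representatives, by Ramsey's theorem and saturation
(`TypeDefEquiv.exists_isIndiscernible_lift`); a finite sequence has no Dedekind cuts.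
-/

namespace ModelTheory

/-! ### Automorphisms, saturation and definable sets -/

section Monster

variable {L : FirstOrder.Language.{u, v}} {M : Type w} [L.Structure M] {κ : Cardinal.{w}}

theorem IsStronglyHomogeneous.exists_equiv (hM : IsStronglyHomogeneous L M κ) {γ : Type w}
    (hγ : #γ < κ) {x y : γ → M} (h : ∀ φ : L.Formula γ, φ.Realize x ↔ φ.Realize y) :
    ∃ σ : M ≃[L] M, ∀ g, σ (x g) = y g := by
  choose r hr using fun t : Set.range x => t.2
  obtain ⟨σ, hσ⟩ := hM (Set.range x) (Cardinal.mk_range_le.trans_lt hγ) (y ∘ r) (fun φ => by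
    have := h (φ.relabel r)
    rw [Language.Formula.realize_relabel, Language.Formula.realize_relabel] at this
    rw [← this]
    exact iff_of_eq (congrArg _ (funext fun t => (hr t).symm)))
  refine ⟨σ, fun g => (hσ ⟨x g, g, rfl⟩).trans ?_⟩
  have := h ((Language.Term.var (r ⟨x g, g, rfl⟩)).equal (Language.Term.var g))
  simp only [Language.Formula.realize_equal, Language.Term.realize_var] at this
  exact this.1 (hr ⟨x g, g, rfl⟩)

/-- Saturation in terms of definable sets: a family of sets definable over a small set of
parameters, in a small number of variables, has a common point if it has the finite intersection
property. -/
theorem IsSaturated.exists_forall_mem (hM : IsSaturated L M κ) {A : Set M} (hA : #A < κ)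
    {α : Type w} (hα : #α < κ) {J : Type*} {Q : J → Set (α → M)}
    (hQ : ∀ j, A.Definable L (Q j)) (h : ∀ s : Finset J, ∃ c, ∀ j ∈ s, c ∈ Q j) :
    ∃ c, ∀ j, c ∈ Q j := by
  classical
  choose φ hφ using hQ
  obtain ⟨c, hc⟩ := hM A hA α hα (Set.range φ) (fun p₀ hp₀ => by
    obtain ⟨s, rfl⟩ : ∃ s : Finset J, s.image φ = p₀ := by
      obtain ⟨s, -, hs⟩ := Finset.subset_set_image_iff.1 (by simpa using hp₀ :
        (p₀ : Set (L[[A]].Formula α)) ⊆ φ '' Set.univ)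
      exact ⟨s, hs⟩
    obtain ⟨c, hc⟩ := h s
    refine ⟨c, fun ψ hψ => ?_⟩
    obtain ⟨j, hj, rfl⟩ := Finset.mem_image.1 hψ
    have := hc j hj
    rwa [hφ] at this)
  exact ⟨c, fun j => by rw [hφ]; exact hc _ ⟨j, rfl⟩⟩

/-- If every coordinate of `v c` is a coordinate of `c` or a parameter in `A`, then the condition
`φ(v c)` on `c` is definable over `A`. -/
theorem definable_realize {A : Set M} {α : Type*} {γ : Type*} (φ : L.Formula γ)
    (v : (α → M) → γ → M)
    (hv : ∀ g, (∃ i, ∀ c, v c g = c i) ∨ ∃ m ∈ A, ∀ c, v c g = m) :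
    A.Definable L {c | φ.Realize (v c)} := by
  have hf : ∀ g, ∃ t : A ⊕ α, ∀ c, v c g = Sum.elim (fun m : A => (m : M)) c t := fun g => by
    rcases hv g with ⟨i, hi⟩ | ⟨m, hm, hi⟩
    · exact ⟨Sum.inr i, hi⟩
    · exact ⟨Sum.inl ⟨m, hm⟩, hi⟩
  choose f hf using hf
  refine Set.definable_iff_exists_formula_sum.2 ⟨φ.relabel f, ?_⟩
  ext c
  simp only [Set.mem_ofPred_eq, Language.Formula.realize_relabel]
  exact iff_of_eq (congrArg _ (funext fun g => hf g c))

theorem exists_finset_support {L' : FirstOrder.Language} [L'.Structure M] {α : Type*}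
    (φ : L'.Formula α) :
    ∃ (t : Finset α) (ψ : L'.Formula t),
      ∀ v : α → M, ψ.Realize (fun x => v x) ↔ φ.Realize v := by
  classical
  exact ⟨φ.freeVarFinset, φ.restrictFreeVar id, fun v =>
    Language.BoundedFormula.realize_restrictFreeVar v (fun _ => rfl)⟩

/-- Definable sets are closed under projections along any, possibly infinite, set of coordinates,
since a formula involves only finitely many of them. -/
theorem definable_exists [Nonempty M] {A : Set M} {α β : Type*} {S : Set (α ⊕ β → M)}
    (hS : A.Definable L S) :
    A.Definable L {v : α → M | ∃ x : β → M, Sum.elim v x ∈ S} := by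
  classical
  obtain ⟨φ, rfl⟩ := hS
  obtain ⟨t, ψ, hψ⟩ := exists_finset_support (M := M) φ
  let r : t → α ⊕ t := fun y => Sum.elim Sum.inl (fun _ => Sum.inr y) y.1
  refine ⟨(ψ.relabel r).iExs t, ?_⟩
  ext v
  simp only [Set.mem_ofPred_eq, Language.Formula.realize_iExs, Language.Formula.realize_relabel]
  constructor
  · rintro ⟨x, hx⟩
    refine ⟨fun y => Sum.elim v x y, ?_⟩
    convert (hψ _).2 hx using 1
    ext ⟨y | y, hy⟩ <;> simp [r]
  · rintro ⟨i, hi⟩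
    refine ⟨fun y => if h : Sum.inr y ∈ t then i ⟨_, h⟩ else Classical.arbitrary M, ?_⟩
    refine (hψ _).1 ?_
    convert hi using 1
    ext ⟨y | y, hy⟩ <;> simp [r, hy]

end Monster

/-! ### Indiscernible sequences of tuples and of hyperimaginaries -/

section Types

variable {L : FirstOrder.Language.{u, v}} {M : Type w} [L.Structure M] {ι : Type w}

theorem SameType.trans {n : ℕ} {x y z : Fin n → ι → M} (h : SameType L n x y)
    (h' : SameType L n y z) : SameType L n x z := fun φ => (h φ).trans (h' φ)

theorem SameType.symm {n : ℕ} {x y : Fin n → ι → M} (h : SameType L n x y) :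
    SameType L n y x := fun φ => (h φ).symm

theorem sameType_comp (σ : M ≃[L] M) {n : ℕ} (x : Fin n → ι → M) :
    SameType L n x (fun k => σ ∘ x k) := fun φ =>
  (Language.StrongHomClass.realize_formula σ φ (v := fun p : Fin n × ι => x p.1 p.2)).symm

theorem isIndiscernible_comp (σ : M ≃[L] M) {K : Type*} [LinearOrder K] {x : K → ι → M}
    (h : IsIndiscernible (SameType L) x) :
    IsIndiscernible (SameType L) (fun k => (σ ∘ x k : ι → M)) := fun n i j hi hj =>
  ((sameType_comp σ _).symm.trans (h n i j hi hj)).trans (sameType_comp σ _)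

theorem SameType.exists_equiv {κ : Cardinal.{w}} (hM : IsMonster L M κ) (hι : #ι < κ) {n : ℕ}
    {x y : Fin n → ι → M} (h : SameType L n x y) : ∃ σ : M ≃[L] M, ∀ k, σ ∘ x k = y k := by
  have hc : #(Fin n × ι) < κ := by
    rw [Cardinal.mk_prod]
    refine Cardinal.mul_lt_of_lt hM.aleph0_lt.le ?_ ?_
    · simpa using Cardinal.natCast_lt_aleph0.trans hM.aleph0_lt
    · simpa using hι
  obtain ⟨σ, hσ⟩ := hM.isStronglyHomogeneous.exists_equiv hc h
  exact ⟨σ, fun k => funext fun i => hσ (k, i)⟩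

/-- If `I` is small, a family of `ι`-tuples whose finite subfamilies have the same types as those
of `x` is conjugate to `x`. -/
theorem exists_equiv_of_forall_sameType {κ : Cardinal.{w}} (hM : IsMonster L M κ) (hι : #ι < κ)
    {I : Type w} [LinearOrder I] (hI : #I < κ) {x y : I → ι → M}
    (h : ∀ (n : ℕ) (i : Fin n → I), StrictMono i →
      SameType L n (fun k => x (i k)) (fun k => y (i k))) :
    ∃ σ : M ≃[L] M, ∀ i, σ ∘ x i = y i := by
  classical
  have hc : #(I × ι) < κ := by
    rw [Cardinal.mk_prod]
    refine Cardinal.mul_lt_of_lt hM.aleph0_lt.le ?_ ?_ <;> simpa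
  obtain ⟨σ, hσ⟩ := hM.isStronglyHomogeneous.exists_equiv hc
    (x := fun p => x p.1 p.2) (y := fun p => y p.1 p.2) (fun φ => by
      obtain ⟨t, ψ, hψ⟩ := exists_finset_support (M := M) φ
      let F : Finset I := t.image Prod.fst
      let f := F.orderEmbOfFin rfl
      have hf : ∀ p : t, ∃ k, f k = p.1.1 := fun p => by
        have : p.1.1 ∈ Set.range f := by
          rw [Finset.range_orderEmbOfFin]
          exact Finset.mem_coe.2 (Finset.mem_image_of_mem _ p.2)
        exact this
      choose g hg using hf
      have := h _ f f.strictMono (ψ.relabel fun p => (g p, p.1.2))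
      simp only [Language.Formula.realize_relabel] at this
      rw [← hψ, ← hψ]
      convert this using 2 <;> (ext p; simp [hg]))
  exact ⟨σ, fun k => funext fun i => hσ (k, i)⟩

namespace TypeDefEquiv

variable (E : TypeDefEquiv L M ι)

theorem sameType_cls_iff {n : ℕ} {x y : Fin n → ι → M} :
    E.SameType n (fun k => E.cls (x k)) (fun k => E.cls (y k)) ↔
      ∃ σ : M ≃[L] M, ∀ k, E.toSetoid (σ ∘ x k) (y k) :=
  exists_congr fun _ => forall_congr' fun _ => Quotient.eq (r := E.toSetoid)

/-- The families `x / E` and `y / E`, restricted to the indices in `G`, are conjugate. -/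
def ConjOn {I : Type*} (G : Set I) (x y : I → ι → M) : Prop :=
  ∃ σ : M ≃[L] M, ∀ i ∈ G, E.toSetoid (σ ∘ x i) (y i)

variable {E}

theorem rel_symm_comp {σ : M ≃[L] M} {x y : ι → M} (h : E.toSetoid (σ ∘ x) y) :
    E.toSetoid (σ.symm ∘ y) x := by
  have := E.rel_comp σ.symm h
  rw [← Function.comp_assoc] at this
  have h2 : (σ.symm : M → M) ∘ σ = id := funext fun m => σ.symm_apply_apply m
  rw [h2] at this
  exact E.toSetoid.symm' this

theorem rel_comp_trans {σ τ : M ≃[L] M} {x y z : ι → M} (h : E.toSetoid (σ ∘ x) y)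
    (h' : E.toSetoid (τ ∘ y) z) : E.toSetoid ((τ.comp σ) ∘ x) z :=
  E.toSetoid.trans' (E.rel_comp τ h) h'

/-- The image of an indiscernible sequence of tuples in the sort of `E` is indiscernible. -/
theorem isIndiscernible_cls {κ : Cardinal.{w}} (hM : IsMonster L M κ) (hι : #ι < κ)
    {K : Type*} [LinearOrder K] {x : K → ι → M} (h : IsIndiscernible (ModelTheory.SameType L) x) :
    IsIndiscernible E.SameType (fun k => E.cls (x k)) := fun n i j hi hj => by
  obtain ⟨σ, hσ⟩ := (h n i j hi hj).exists_equiv hM hι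
  exact (sameType_cls_iff E).2 ⟨σ, fun k => by rw [hσ]⟩

end TypeDefEquiv

end Types

/-! ### Ramsey's theorem -/

section Ramsey

variable {α : Type*}

/-- The infinite Ramsey theorem for colourings of the `n`-element subsets with two colours. -/
theorem exists_infinite_homogeneous [DecidableEq α] (n : ℕ) :
    ∀ (H₀ : Set α), H₀.Infinite → ∀ c : Finset α → Prop,
      ∃ H ⊆ H₀, H.Infinite ∧ ∃ b : Prop, ∀ s : Finset α, ↑s ⊆ H → s.card = n → (c s ↔ b) := by
  induction n with
  | zero =>
    intro H₀ h c
    refine ⟨H₀, subset_rfl, h, c ∅, fun s _ hs => ?_⟩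
    rw [Finset.card_eq_zero.1 hs]
  | succ n ih =>
    intro H₀ h c
    have step : ∀ X : {X : Set α // X.Infinite}, ∃ (x : α) (Y : {Y : Set α // Y.Infinite})
        (b : Prop), x ∈ X.1 ∧ Y.1 ⊆ X.1 \ {x} ∧
          ∀ s : Finset α, ↑s ⊆ Y.1 → s.card = n → (c (insert x s) ↔ b) := fun X => by
      obtain ⟨x, hx⟩ := X.2.nonempty
      obtain ⟨Y, hY, hi, b, hb⟩ := ih (X.1 \ {x}) (X.2.sdiff (Set.finite_singleton x))
        (fun s => c (insert x s))
      exact ⟨x, ⟨Y, hi⟩, b, hx, hY, hb⟩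
    choose pt next col hpt hnext hcol using step
    -- Points `pt (X k)` of a decreasing sequence of infinite sets `X k`, such that the colour of a set
    -- of such points depends only on its point of least index.
    let X : ℕ → {X : Set α // X.Infinite} := fun k => next^[k] ⟨H₀, h⟩
    have hX : ∀ k, X (k + 1) = next (X k) := fun k => Function.iterate_succ_apply' _ _ _
    have hsub : ∀ k, (X (k + 1)).1 ⊆ (X k).1 \ {pt (X k)} := fun k => by
      rw [hX]; exact hnext _
    have hanti : Antitone fun k => (X k).1 :=
      antitone_nat_of_succ_le fun k => (hsub k).trans Set.sdiff_subset
    have hlt : ∀ j k, j < k → pt (X k) ∈ (X (j + 1)).1 := fun j k hjk =>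
      hanti (Nat.succ_le_of_lt hjk) (hpt (X k))
    have hinj : Function.Injective fun k => pt (X k) := by
      intro j k hjk
      by_contra hne
      rcases lt_or_gt_of_ne hne with hl | hl
      · exact (hsub _ (hlt _ _ hl)).2 hjk.symm
      · exact (hsub _ (hlt _ _ hl)).2 hjk
    obtain ⟨b, K, hK, hKb⟩ : ∃ (b : Prop) (K : Set ℕ), K.Infinite ∧
        ∀ k ∈ K, (col (X k) ↔ b) := by
      by_cases hfin : {k | col (X k)}.Infinite
      · exact ⟨True, _, hfin, fun k hk => iff_true_intro hk⟩
      · exact ⟨False, _, (Set.not_infinite.1 hfin).infinite_compl, fun k hk => iff_false_intro hk⟩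
    refine ⟨(fun k => pt (X k)) '' K, ?_, hK.image hinj.injOn, b, fun s hs hsc => ?_⟩
    · rintro _ ⟨k, -, rfl⟩
      exact hanti (Nat.zero_le k) (hpt (X k))
    · have hne : ∃ k, pt (X k) ∈ s := by
        obtain ⟨y, hy⟩ := Finset.card_pos.1 (by omega : 0 < s.card)
        obtain ⟨k, -, rfl⟩ := hs hy
        exact ⟨k, hy⟩
      classical
      have hk := Nat.find_spec hne
      have hmin := fun j => Nat.find_min' hne (m := j)
      generalize Nat.find hne = k at hk hmin
      have hkK : k ∈ K := by
        obtain ⟨j, hj, hjk⟩ := hs hk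
        rwa [← hinj hjk]
      rw [← Finset.insert_erase hk, hcol, hKb k hkK]
      · intro y hy
        obtain ⟨hy1, hy2⟩ := Finset.mem_erase.1 hy
        obtain ⟨j, -, rfl⟩ := hs hy2
        rw [← hX]
        refine hlt _ _ (lt_of_le_of_ne (hmin j hy2) ?_)
        rintro rfl
        exact hy1 rfl
      · rw [Finset.card_erase_of_mem hk, hsc]; rfl

theorem exists_infinite_homogeneous_finset [DecidableEq α] [Infinite α] {J : Type*} (s : Finset J)
    (n : J → ℕ) (c : J → Finset α → Prop) :
    ∃ H : Set α, H.Infinite ∧ ∀ j ∈ s, ∃ b : Prop, ∀ t : Finset α,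
      ↑t ⊆ H → t.card = n j → (c j t ↔ b) := by
  classical
  induction s using Finset.induction_on with
  | empty => exact ⟨Set.univ, Set.infinite_univ, by simp⟩
  | insert j s hj ih =>
    obtain ⟨H, hH, h⟩ := ih
    obtain ⟨H', hs, hH', b, hb⟩ := exists_infinite_homogeneous (n j) H hH (c j)
    refine ⟨H', hH', fun i hi => ?_⟩
    rcases Finset.mem_insert.1 hi with rfl | hi
    · exact ⟨b, hb⟩
    · obtain ⟨b', hb'⟩ := h i hi
      exact ⟨b', fun t ht => hb' t (ht.trans hs)⟩

end Ramsey

/-! ### Finite subsets of linear orders and Dedekind cuts -/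

section Order

variable {I : Type*} [LinearOrder I]

theorem exists_strictMonoOn_mem_infinite (F : Finset I) {H : Set I} (hH : H.Infinite) :
    ∃ h : I → I, StrictMonoOn h F ∧ ∀ x ∈ F, h x ∈ H := by
  obtain ⟨t, htH, ht⟩ := hH.exists_subset_card_eq F.card
  refine ⟨fun x => if hx : x ∈ F then t.orderEmbOfFin ht ((F.orderIsoOfFin rfl).symm ⟨x, hx⟩)
    else x, fun x hx y hy hxy => ?_, fun x hx => ?_⟩
  · rw [Finset.mem_coe] at hx hy
    simpa [hx, hy] using hxy
  · simp only [hx, dif_pos]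
    exact htH (Finset.orderEmbOfFin_mem t ht _)

theorem exists_strictMonoOn_of_noMax (G : Finset I) {S : Set I} (hne : S.Nonempty)
    (hS : ∀ x ∈ S, ∃ y ∈ S, x < y) : ∃ f : I → I, StrictMonoOn f G ∧ ∀ x, f x ∈ S := by
  have : Nonempty S := hne.to_subtype
  have : NoMaxOrder S := ⟨fun x => by
    obtain ⟨y, hy, hxy⟩ := hS x x.2
    exact ⟨⟨y, hy⟩, hxy⟩⟩
  obtain ⟨z, hz⟩ := Nat.exists_strictMono S
  refine ⟨fun x => z (G.filter (· < x)).card, fun x hx y hy hxy => hz ?_, fun x => (z _).2⟩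
  refine Finset.card_lt_card (Finset.ssubset_iff_of_subset ?_ |>.2 ⟨x, ?_, ?_⟩)
  · intro w hw
    rw [Finset.mem_filter] at hw ⊢
    exact ⟨hw.1, hw.2.trans hxy⟩
  · exact Finset.mem_filter.2 ⟨hx, hxy⟩
  · simp

theorem exists_strictMonoOn_of_noMin (G : Finset I) {S : Set I} (hne : S.Nonempty)
    (hS : ∀ x ∈ S, ∃ y ∈ S, y < x) : ∃ f : I → I, StrictMonoOn f G ∧ ∀ x, f x ∈ S := by
  obtain ⟨f, hf, hm⟩ := exists_strictMonoOn_of_noMax (I := Iᵒᵈ) G (S := S) hne hS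
  exact ⟨f, fun x hx y hy hxy => hf hy hx hxy, hm⟩

theorem exists_mem_forall_lt (F : Finset I) {S : Set I} (hne : S.Nonempty)
    (hS : ∀ x ∈ S, ∃ y ∈ S, x < y) : ∃ y ∈ S, ∀ i ∈ F, i ∈ S → i < y := by
  classical
  induction F using Finset.induction_on with
  | empty => exact ⟨hne.some, hne.some_mem, by simp⟩
  | insert a F ha ih =>
    obtain ⟨y, hy, h⟩ := ih
    by_cases haS : a ∈ S
    · obtain ⟨z, hz, hyz⟩ := hS (max a y) (by rcases max_choice a y with h | h <;> rwa [h])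
      refine ⟨z, hz, fun i hi hiS => ?_⟩
      rcases Finset.mem_insert.1 hi with rfl | hi
      · exact (le_max_left _ _).trans_lt hyz
      · exact (h i hi hiS).trans ((le_max_right _ _).trans_lt hyz)
    · refine ⟨y, hy, fun i hi hiS => ?_⟩
      rcases Finset.mem_insert.1 hi with rfl | hi
      · exact absurd hiS haS
      · exact h i hi hiS

/-- The convex set of the elements of `I` that lie in the same position as the cut `C` with respect
to the elements of the finite set `F`. -/
def gap (F : Finset I) (C : LowerSet I) : Set I :=
  {k | ∀ i ∈ F, (i ∈ C → i < k) ∧ (i ∉ C → k < i)}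

variable {F : Finset I} {C D : LowerSet I}

theorem notMem_of_mem_gap {k : I} (hk : k ∈ gap F C) : k ∉ F := fun h => by
  by_cases hC : k ∈ C
  · exact lt_irrefl _ ((hk k h).1 hC)
  · exact lt_irrefl _ ((hk k h).2 hC)

theorem gap_mono {F' : Finset I} (h : F ⊆ F') : gap F' C ⊆ gap F C := fun _ hk i hi => hk i (h hi)

theorem gap_convex {x y z : I} (hx : x ∈ gap F C) (hz : z ∈ gap F C) (hxy : x ≤ y)
    (hyz : y ≤ z) : y ∈ gap F C := fun i hi =>
  ⟨fun h => ((hx i hi).1 h).trans_le hxy, fun h => hyz.trans_lt ((hz i hi).2 h)⟩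

/-- An element outside the gap lies on the same side of the cut as of any element of the gap. -/
theorem lt_iff_mem_of_notMem_gap {m x : I} (hm : m ∈ gap F C) (hx : x ∉ gap F C) :
    x < m ↔ x ∈ C := by
  constructor
  · intro h
    by_contra hxC
    exact hx fun i hi => ⟨fun hiC => lt_of_not_ge fun hle => hxC (C.lower hle hiC),
      fun hiC => h.trans ((hm i hi).2 hiC)⟩
  · intro hxC
    by_contra h
    exact hx fun i hi => ⟨fun hiC => ((hm i hi).1 hiC).trans_le (not_lt.1 h),
      fun hiC => lt_of_not_ge fun hle => hiC (C.lower hle hxC)⟩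

theorem nonempty_and_exists_lt_of_aleph0_le_cof {α : Type*} [LinearOrder α] (h : ℵ₀ ≤ Order.cof α) :
    Nonempty α ∧ ∀ x : α, ∃ y, x < y := by
  have : Nonempty α := by
    rw [← Order.cof_ne_zero_iff]
    rintro h0
    rw [h0] at h
    exact absurd h (not_le.2 Cardinal.aleph0_pos)
  refine ⟨this, fun x => ?_⟩
  have h1 := Order.one_lt_cof_iff.1 (Order.aleph0_le_cof_iff.1 h)
  obtain ⟨y, hy⟩ := h1.exists_not_le x
  exact ⟨y, not_le.1 hy⟩

theorem IsDedekind.left (h : IsDedekind C) :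
    (C : Set I).Nonempty ∧ ∀ x ∈ (C : Set I), ∃ y ∈ (C : Set I), x < y := by
  obtain ⟨⟨x⟩, h⟩ := nonempty_and_exists_lt_of_aleph0_le_cof h.1
  refine ⟨⟨x, x.2⟩, fun x hx => ?_⟩
  obtain ⟨y, hy⟩ := h ⟨x, hx⟩
  exact ⟨y, y.2, hy⟩

theorem IsDedekind.right (h : IsDedekind C) :
    (C : Set I)ᶜ.Nonempty ∧ ∀ x ∈ (C : Set I)ᶜ, ∃ y ∈ (C : Set I)ᶜ, y < x := by
  obtain ⟨⟨x⟩, h⟩ := nonempty_and_exists_lt_of_aleph0_le_cof h.2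
  refine ⟨⟨x.ofDual, x.ofDual.2⟩, fun x hx => ?_⟩
  obtain ⟨y, hy⟩ := h (OrderDual.toDual ⟨x, hx⟩)
  exact ⟨y.ofDual, y.ofDual.2, hy⟩

theorem IsDedekind.infinite (h : IsDedekind C) : Infinite I := by
  have : Nonempty (C : Set I) := h.left.1.to_subtype
  have : NoMaxOrder (C : Set I) := ⟨fun x => by
    obtain ⟨y, hy, hxy⟩ := h.left.2 x x.2
    exact ⟨⟨y, hy⟩, hxy⟩⟩
  exact Infinite.of_injective (fun x : (C : Set I) => x.1) Subtype.val_injective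

theorem IsDedekind.gap_left (h : IsDedekind C) (F : Finset I) :
    (gap F C ∩ C).Nonempty ∧ ∀ x ∈ gap F C ∩ C, ∃ y ∈ gap F C ∩ C, x < y := by
  have key : ∀ y ∈ C, (∀ i ∈ F, i ∈ C → i < y) → y ∈ gap F C ∩ C := fun y hy hF =>
    ⟨fun i hi => ⟨hF i hi, fun hiC => lt_of_not_ge fun hle => hiC (C.lower hle hy)⟩, hy⟩
  constructor
  · obtain ⟨y, hy, hF⟩ := exists_mem_forall_lt F h.left.1 h.left.2
    exact ⟨y, key y hy hF⟩
  · rintro x ⟨hx, hxC⟩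
    obtain ⟨y, hy, hxy⟩ := h.left.2 x hxC
    exact ⟨y, key y hy fun i hi hiC => ((hx i hi).1 hiC).trans hxy, hxy⟩

theorem IsDedekind.gap_right (h : IsDedekind C) (F : Finset I) :
    (gap F C \ C).Nonempty ∧ ∀ x ∈ gap F C \ C, ∃ y ∈ gap F C \ C, y < x := by
  have key : ∀ y ∉ C, (∀ i ∈ F, i ∉ C → y < i) → y ∈ gap F C \ C := fun y hy hF =>
    ⟨fun i hi => ⟨fun hiC => lt_of_not_ge fun hle => hy (C.lower hle hiC), hF i hi⟩, hy⟩
  constructor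
  · obtain ⟨y, hy, hF⟩ := exists_mem_forall_lt (I := Iᵒᵈ) F h.right.1 h.right.2
    exact ⟨y, key y hy hF⟩
  · rintro x ⟨hx, hxC⟩
    obtain ⟨y, hy, hxy⟩ := h.right.2 x hxC
    exact ⟨y, key y hy fun i hi hiC => hxy.trans ((hx i hi).2 hiC), hxy⟩

/-- A finite subset of `I` can be moved inside the gap of the cut `C` so that the cut takes the
position of a given point `m`. -/
theorem IsDedekind.exists_strictMonoOn (h : IsDedekind C) (F G : Finset I) (m : I) :
    ∃ e : I → I, StrictMonoOn e G ∧ (∀ x ∉ gap F C, e x = x) ∧ (∀ x ∈ gap F C, e x ∈ gap F C) ∧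
      ∀ x ∈ gap F C, (x < m ↔ e x ∈ C) := by
  classical
  obtain ⟨f, hf, hfm⟩ := exists_strictMonoOn_of_noMax G (h.gap_left F).1 (h.gap_left F).2
  obtain ⟨g, hg, hgm⟩ := exists_strictMonoOn_of_noMin G (h.gap_right F).1 (h.gap_right F).2
  let e : I → I := fun x => if x ∈ gap F C then if x < m then f x else g x else x
  have he : ∀ x ∈ gap F C, e x ∈ gap F C := fun x hx => by
    by_cases hxm : x < m
    · simpa [e, hx, hxm] using (hfm x).1
    · simpa [e, hx, hxm] using (hgm x).1
  have he' : ∀ x ∉ gap F C, e x = x := fun x hx => by simp [e, hx]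
  refine ⟨e, fun x hx y hy hxy => ?_, he', he, fun x hx => ?_⟩
  · by_cases hxg : x ∈ gap F C <;> by_cases hyg : y ∈ gap F C
    · by_cases hym : y < m
      · have hxm := hxy.trans hym
        simpa [e, hxg, hyg, hym, hxm] using hf hx hy hxy
      · by_cases hxm : x < m
        · simp only [e, hxg, hyg, hym, hxm, if_true, if_false]
          exact lt_of_not_ge fun hle => (hgm y).2 (C.lower hle (hfm x).2)
        · simpa [e, hxg, hyg, hym, hxm] using hg hx hy hxy
    · rw [he' y hyg]
      exact lt_of_not_ge fun hle => hyg (gap_convex hxg (he x hxg) hxy.le hle)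
    · rw [he' x hxg]
      exact lt_of_not_ge fun hle => hxg (gap_convex (he y hyg) hyg hle hxy.le)
    · rwa [he' x hxg, he' y hyg]
  · by_cases hxm : x < m
    · simpa [e, hx, hxm] using (hfm x).2
    · simpa [e, hx, hxm] using (hgm x).2

/-- A finite subset `G` of `I` can be moved, fixing the points of `F`, so that two cuts separated
by a point of `F` take the positions of two given points of their gaps. -/
theorem exists_strictMonoOn_two (hC : IsDedekind C) (hD : IsDedekind D)
    {t : I} (htF : t ∈ F) (htC : t ∉ C) (htD : t ∈ D) (G : Finset I) {m n : I}
    (hm : m ∈ gap F C) (hn : n ∈ gap F D) :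
    ∃ e : I → I, StrictMonoOn e G ∧ (∀ x ∈ F, e x = x) ∧ (∀ x, x < m ↔ e x ∈ C) ∧
      ∀ x, x < n ↔ e x ∈ D := by
  have h1 : ∀ x ∈ gap F C, x < t := fun x hx => (hx t htF).2 htC
  have h2 : ∀ x ∈ gap F D, t < x := fun x hx => (hx t htF).1 htD
  have h1n : ∀ x ∈ gap F C, x ∉ gap F D := fun x hx hx' => lt_asymm (h1 x hx) (h2 x hx')
  obtain ⟨e₁, he₁, hid₁, hg₁, hm₁⟩ := hC.exists_strictMonoOn F G m
  obtain ⟨e₂, he₂, hid₂, hg₂, hn₂⟩ := hD.exists_strictMonoOn F (G.image e₁) n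
  have hid : ∀ x, x ∉ gap F C → x ∉ gap F D → e₂ (e₁ x) = x := fun x hx hx' => by
    rw [hid₁ x hx, hid₂ x hx']
  have hxC : ∀ x ∈ gap F C, e₂ (e₁ x) = e₁ x := fun x hx => hid₂ _ (h1n _ (hg₁ x hx))
  have hxD : ∀ x ∈ gap F D, e₂ (e₁ x) = e₂ x := fun x hx => by
    rw [hid₁ x fun h => h1n x h hx]
  refine ⟨fun x => e₂ (e₁ x), fun x hx y hy hxy => he₂ ?_ ?_ (he₁ hx hy hxy), fun x hx => ?_,
    fun x => ?_, fun x => ?_⟩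
  · exact Finset.mem_coe.2 (Finset.mem_image_of_mem _ hx)
  · exact Finset.mem_coe.2 (Finset.mem_image_of_mem _ hy)
  · exact hid x (fun h => notMem_of_mem_gap h hx) (fun h => notMem_of_mem_gap h hx)
  · by_cases hx : x ∈ gap F C
    · simpa only [hxC x hx] using hm₁ x hx
    · by_cases hx' : x ∈ gap F D
      · simp only [hxD x hx']
        exact iff_of_false (not_lt.2 ((h1 m hm).trans (h2 x hx')).le)
          fun h => htC (C.lower (h2 _ (hg₂ x hx')).le h)
      · simpa only [hid x hx hx'] using lt_iff_mem_of_notMem_gap hm hx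
  · by_cases hx : x ∈ gap F C
    · simp only [hxC x hx]
      exact iff_of_true ((h1 x hx).trans (h2 n hn)) (D.lower (h1 _ (hg₁ x hx)).le htD)
    · by_cases hx' : x ∈ gap F D
      · simpa only [hxD x hx'] using hn₂ x hx'
      · simpa only [hid x hx hx'] using lt_iff_mem_of_notMem_gap hn hx'

end Order

variable {L : FirstOrder.Language.{u, v}} {M : Type w} [L.Structure M] {κ : Cardinal.{w}}
  {ι : Type w}

/-! ### Alternation of definable sets along indiscernible sequences -/

section NIP

/-- In an NIP theory, a set definable with parameters cannot alternate arbitrarily often along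
automorphic copies of an indiscernible sequence: otherwise, by saturation, it would alternate
infinitely often along one indiscernible sequence. -/
theorem IsNIP.exists_forall_not_alternating (hNIP : IsNIP L M) (hM : IsMonster L M κ)
    (hι : #ι < κ) {A : Set M} (hA : #A < κ) {P : Set (ι → M)} (hP : A.Definable L P)
    {I : Type*} [LinearOrder I] {a : I → ι → M} (ha : IsIndiscernible (SameType L) a)
    {z : ℕ → I} (hz : StrictMono z) :
    ∃ N : ℕ, ∀ σ : M ≃[L] M, ¬ ∀ l < N, (σ ∘ a (z l) ∈ P ↔ Even l) := by
  classical
  by_contra! hcon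
  have hcard : #(ULift.{w} ℕ × ι) < κ := by
    rw [Cardinal.mk_prod]
    refine Cardinal.mul_lt_of_lt hM.aleph0_lt.le ?_ ?_
    · simpa using hM.aleph0_lt
    · simpa using hι
  let e : ULift.{w} ℕ × ι → M := fun p => a (z p.1.down) p.2
  obtain ⟨c, hc⟩ := hM.isSaturated.exists_forall_mem hA hcard
    (J := L.Formula (ULift.{w} ℕ × ι) ⊕ ℕ)
    (Q := Sum.elim (fun χ => {c | χ.Realize e → χ.Realize c})
      (fun l => {c | (fun t => c (⟨l⟩, t)) ∈ P ↔ Even l}))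
    (by
      rintro (χ | l)
      · by_cases h : χ.Realize e
        · simpa [h] using definable_realize χ (fun c => c) (fun g => Or.inl ⟨g, fun _ => rfl⟩)
        · simp [h]
      · have h1 := hP.preimage_comp fun t : ι => ((⟨l⟩, t) : ULift.{w} ℕ × ι)
        by_cases h : Even l
        · simp only [Sum.elim_inr, h, iff_true]
          exact h1
        · simp only [Sum.elim_inr, h, iff_false]
          exact h1.compl)
    (fun s => by
      obtain ⟨σ, hσ⟩ := hcon (s.toRight.sup id + 1)
      refine ⟨σ ∘ e, ?_⟩
      rintro (χ | l) hl
      · exact (Language.StrongHomClass.realize_formula σ χ).2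
      · exact hσ l (Nat.lt_succ_of_le (Finset.le_sup (f := id) (Finset.mem_toRight.2 hl))))
  have hce : ∀ χ : L.Formula (ULift.{w} ℕ × ι), χ.Realize e ↔ χ.Realize c := fun χ => by
    refine ⟨hc (Sum.inl χ), fun h => ?_⟩
    by_contra hn
    exact hc (Sum.inl χ.not) (by simpa using hn) h
  obtain ⟨φ, hφ⟩ := Set.definable_iff_exists_formula_sum.1 hP
  obtain ⟨t, ψ, hψ⟩ := exists_finset_support (M := M) φ
  let r : t → t.toRight ⊕ t.toLeft := fun y => match y with
    | ⟨Sum.inl x, h⟩ => Sum.inr ⟨x, Finset.mem_toLeft.2 h⟩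
    | ⟨Sum.inr x, h⟩ => Sum.inl ⟨x, Finset.mem_toRight.2 h⟩
  let er := t.toRight.equivFin
  let el := t.toLeft.equivFin
  refine hNIP _ _ (ψ.relabel (Sum.map er el ∘ r)) ⟨fun l x => c (⟨l⟩, (er.symm x).1),
    fun x => (el.symm x).1, fun n i j hi hj χ => ?_, fun l => ?_⟩
  · have h1 := hce (χ.relabel fun p => (⟨i p.1⟩, (er.symm p.2).1))
    have h2 := hce (χ.relabel fun p => (⟨j p.1⟩, (er.symm p.2).1))
    have h3 := ha n (z ∘ i) (z ∘ j) (hz.comp hi) (hz.comp hj)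
      (χ.relabel fun p => (p.1, (er.symm p.2).1))
    simp only [Language.Formula.realize_relabel] at h1 h2 h3
    exact (h1.symm.trans h3).trans h2
  · have h1 := hc (Sum.inr l)
    simp only [Sum.elim_inr, Set.mem_ofPred_eq, hφ] at h1
    rw [← h1, ← hψ, Language.Formula.realize_relabel]
    refine iff_of_eq (congrArg _ (funext ?_))
    rintro ⟨x | x, hx⟩ <;> simp [r]

end NIP

/-! ### Sequences of hyperimaginaries -/

section Hyper

variable {E : TypeDefEquiv L M ι} {I : Type w} [LinearOrder I]

namespace TypeDefEquiv

theorem ConjOn.trans {J : Type*} {G : Set J} {x y z : J → ι → M} (h : E.ConjOn G x y)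
    (h' : E.ConjOn G y z) : E.ConjOn G x z := by
  obtain ⟨σ, hσ⟩ := h
  obtain ⟨τ, hτ⟩ := h'
  exact ⟨τ.comp σ, fun i hi => rel_comp_trans (hσ i hi) (hτ i hi)⟩

theorem ConjOn.symm {J : Type*} {G : Set J} {x y : J → ι → M} (h : E.ConjOn G x y) :
    E.ConjOn G y x := by
  obtain ⟨σ, hσ⟩ := h
  exact ⟨σ.symm, fun i hi => rel_symm_comp (hσ i hi)⟩

/-- Conjugacy over a finite set of indices can be checked on its increasing enumeration. -/
theorem conjOn_finset_iff {F : Finset I} {x y : I → ι → M} :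
    E.ConjOn (F : Set I) x y ↔
      E.SameType F.card (fun k => E.cls (x (F.orderEmbOfFin rfl k)))
        (fun k => E.cls (y (F.orderEmbOfFin rfl k))) := by
  rw [sameType_cls_iff]
  refine exists_congr fun σ => ⟨fun h k => h _ (F.orderEmbOfFin_mem rfl k), fun h i hi => ?_⟩
  rw [← F.range_orderEmbOfFin rfl] at hi
  obtain ⟨k, rfl⟩ := hi
  exact h k

theorem conjOn_of_strictMonoOn {a : I → ι → M}
    (ha : IsIndiscernible E.SameType (fun i => E.cls (a i))) {F : Finset I} {e : I → I}
    (he : StrictMonoOn e F) : E.ConjOn (F : Set I) a (fun i => a (e i)) :=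
  conjOn_finset_iff.2 (ha _ _ (fun k => e (F.orderEmbOfFin rfl k))
    (F.orderEmbOfFin rfl).strictMono fun k l hkl => he (F.orderEmbOfFin_mem rfl k)
      (F.orderEmbOfFin_mem rfl l) ((F.orderEmbOfFin rfl).strictMono hkl))

/-- If `b / E` fills the cut `C` and the finite set `G` is moved by `e` in such a way that `C` takes
the position of `m`, then `b / E` behaves over the image of `G` like the term of index `m` behaves
over `G`. -/
theorem conjOn_of_fills {a : I → ι → M}
    (ha : IsIndiscernible E.SameType (fun i => E.cls (a i))) {C : LowerSet I} (hC : IsDedekind C)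
    {b : ι → M} (hb : Fills E.SameType (fun i => E.cls (a i)) C (E.cls b)) {G : Finset I}
    {e : I → I} (he : StrictMonoOn e G) {m : I} (hm : m ∉ G) (hlt : ∀ x, x < m ↔ e x ∈ C) :
    E.ConjOn ((insert m G : Finset I) : Set I) a (fun x => if x = m then b else a (e x)) := by
  classical
  obtain ⟨g, hg, hgC⟩ := exists_strictMonoOn_of_noMax (insert m G) hC.left.1 hC.left.2
  refine (conjOn_of_strictMonoOn ha hg).trans ?_
  set F := insert m G
  -- `pos` places `m` at the new index of `I₁ + b + I₂`, and `x ∈ G` at the index `e x`.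
  let pos : I → ((C : Set I) ⊕ₗ PUnit.{w + 1}) ⊕ₗ ((C : Set I)ᶜ : Set I) := fun x =>
    if x = m then toLex (Sum.inl (toLex (Sum.inr PUnit.unit))) else
    if h : e x ∈ C then toLex (Sum.inl (toLex (Sum.inl ⟨e x, h⟩)))
    else toLex (Sum.inr ⟨e x, h⟩)
  have hpos : StrictMonoOn pos F := by
    intro x hx y hy hxy
    by_cases hxm : x = m
    · subst hxm
      have h1 : y ≠ x := hxy.ne'
      have h2 : e y ∉ C := fun h => lt_asymm hxy ((hlt y).2 h)
      simp [pos, h1, h2]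
    · have hxG : x ∈ G := (Finset.mem_insert.1 hx).resolve_left hxm
      by_cases hym : y = m
      · subst hym
        have h2 : e x ∈ C := (hlt x).1 hxy
        simp [pos, hxm, h2]
      · have hyG : y ∈ G := (Finset.mem_insert.1 hy).resolve_left hym
        have hexy := he hxG hyG hxy
        by_cases hxC : e x ∈ C <;> by_cases hyC : e y ∈ C
        · simpa [pos, hxm, hym, hxC, hyC] using hexy
        · simp [pos, hxm, hym, hxC, hyC]
        · exact absurd (C.lower hexy.le hyC) hxC
        · simpa [pos, hxm, hym, hxC, hyC] using hexy
  have hmem := fun k => F.orderEmbOfFin_mem rfl k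
  have := hb F.card (fun k => toLex (Sum.inl (toLex (Sum.inl ⟨g (F.orderEmbOfFin rfl k), hgC _⟩))))
    (fun k => pos (F.orderEmbOfFin rfl k))
    (fun k l hkl => by simpa using hg (hmem k) (hmem l) ((F.orderEmbOfFin rfl).strictMono hkl))
    (fun k l hkl => hpos (hmem k) (hmem l) ((F.orderEmbOfFin rfl).strictMono hkl))
  have key : ∀ x, concat (concat (part (fun i => E.cls (a i)) (C : Set I)) (single (E.cls b)))
      (part (fun i => E.cls (a i)) (C : Set I)ᶜ) (pos x) =
        E.cls (if x = m then b else a (e x)) := fun x => by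
    simp only [pos]
    split_ifs <;> rfl
  simp only [key] at this
  exact conjOn_finset_iff.2 this

/-- Every infinite indiscernible sequence of hyperimaginaries has an indiscernible sequence of
representatives, by Ramsey's theorem and saturation. -/
theorem exists_isIndiscernible_lift (hM : IsMonster L M κ) (hι : #ι < κ) [Infinite I]
    (hI : #I < κ) {a : I → ι → M} (ha : IsIndiscernible E.SameType (fun i => E.cls (a i))) :
    ∃ c : I → ι → M, IsIndiscernible (ModelTheory.SameType L) c ∧
      ∀ i, E.toSetoid (c i) (a i) := by
  classical
  obtain ⟨Φ, hΦ⟩ := E.typeDefinable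
  have hcard : #(I × ι) < κ := by
    rw [Cardinal.mk_prod]
    refine Cardinal.mul_lt_of_lt hM.aleph0_lt.le ?_ ?_ <;> simpa
  let A : Set M := Set.range fun p : I × ι => a p.1 p.2
  obtain ⟨c, hc⟩ := hM.isSaturated.exists_forall_mem (A := A)
    (Cardinal.mk_range_le.trans_lt hcard) hcard
    (J := (Σ n : ℕ, L.Formula (Fin n × ι) × {i : Fin n → I // StrictMono i} ×
      {i : Fin n → I // StrictMono i}) ⊕ (Φ × I))
    (Q := Sum.elim
      (fun ⟨_, χ, i, j⟩ => {c | χ.Realize (fun p => c (i.1 p.1, p.2)) ↔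
        χ.Realize (fun p => c (j.1 p.1, p.2))})
      (fun q => {c | q.1.1.Realize (Sum.elim (fun t => c (q.2, t)) (a q.2))}))
    (by
      rintro (⟨n, χ, i, j⟩ | ⟨φ, i⟩)
      · have h1 := definable_realize (A := A) χ
          (fun (c : I × ι → M) p => c (i.1 p.1, p.2)) (fun _ => Or.inl ⟨_, fun _ => rfl⟩)
        have h2 := definable_realize (A := A) χ
          (fun (c : I × ι → M) p => c (j.1 p.1, p.2)) (fun _ => Or.inl ⟨_, fun _ => rfl⟩)
        convert (h1.inter h2).union (h1.compl.inter h2.compl) using 1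
        ext c
        simp [iff_iff_and_or_not_and_not]
      · exact definable_realize _ (fun (c : I × ι → M) => Sum.elim (fun t => c (i, t)) (a i)) (by
          rintro (g | g)
          · exact Or.inl ⟨(i, g), fun _ => rfl⟩
          · exact Or.inr ⟨a i g, ⟨(i, g), rfl⟩, fun _ => rfl⟩))
    (fun s => by
      obtain ⟨H, hH, hcol⟩ := exists_infinite_homogeneous_finset s.toLeft (fun q => q.1)
        (fun q (t : Finset I) => ∃ h : t.card = q.1,
          q.2.1.Realize fun p => a (t.orderEmbOfFin h p.1) p.2)
      -- The finitely many indices involved are moved into a homogeneous set `H`, where the formulas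
      -- involved already behave as on an indiscernible sequence.
      let F : Finset I := s.toRight.image Prod.snd ∪ s.toLeft.biUnion fun q =>
        Finset.univ.image q.2.2.1.1 ∪ Finset.univ.image q.2.2.2.1
      obtain ⟨h, hF, hFH⟩ := exists_strictMonoOn_mem_infinite F hH
      obtain ⟨σ, hσ⟩ := (conjOn_of_strictMonoOn ha hF).symm
      refine ⟨fun p => σ (a (h p.1) p.2), ?_⟩
      rintro (⟨n, χ, i, j⟩ | ⟨φ, i⟩) hq
      · obtain ⟨b, hb⟩ := hcol _ (Finset.mem_toLeft.2 hq)
        have key : ∀ i : Fin n → I, StrictMono i → (∀ k, i k ∈ F) →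
            (χ.Realize (fun p => σ (a (h (i p.1)) p.2)) ↔ b) := by
          intro i hi hiF
          have hm : StrictMono fun k => h (i k) := fun k l hkl => hF (hiF k) (hiF l) (hi hkl)
          let t : Finset I := Finset.univ.image fun k => h (i k)
          have htc : t.card = n := by
            rw [Finset.card_image_of_injective _ hm.injective, Finset.card_univ, Fintype.card_fin]
          have ht : (fun k => h (i k)) = t.orderEmbOfFin htc :=
            Finset.orderEmbOfFin_unique htc
              (fun k => Finset.mem_image_of_mem _ (Finset.mem_univ k)) hm
          rw [← hb t ?_ htc]
          · refine (Language.StrongHomClass.realize_formula σ χ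
              (v := fun p => a (h (i p.1)) p.2)).trans ?_
            have ht' : ∀ k, t.orderEmbOfFin htc k = h (i k) := fun k => (congrFun ht k).symm
            simp [htc, ht']
          · intro y hy
            obtain ⟨k, -, rfl⟩ := Finset.mem_image.1 (Finset.mem_coe.1 hy)
            exact hFH _ (hiF k)
        have hsub : ∀ k, i.1 k ∈ F ∧ j.1 k ∈ F := fun k =>
          ⟨Finset.mem_union_right _ (Finset.mem_biUnion.2 ⟨_, Finset.mem_toLeft.2 hq,
            Finset.mem_union_left _ (Finset.mem_image_of_mem _ (Finset.mem_univ k))⟩),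
          Finset.mem_union_right _ (Finset.mem_biUnion.2 ⟨_, Finset.mem_toLeft.2 hq,
            Finset.mem_union_right _ (Finset.mem_image_of_mem _ (Finset.mem_univ k))⟩)⟩
        exact (key i.1 i.2 fun k => (hsub k).1).trans (key j.1 j.2 fun k => (hsub k).2).symm
      · exact (hΦ _ _).1 (hσ i (Finset.mem_coe.2 (Finset.mem_union_left _
          (Finset.mem_image.2 ⟨_, Finset.mem_toRight.2 hq, rfl⟩)))) φ.1 φ.2)
  refine ⟨fun i t => c (i, t), fun n i j hi hj χ => ?_, fun i => (hΦ _ _).2 fun φ hφ => ?_⟩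
  · exact hc (Sum.inl ⟨n, χ, ⟨i, hi⟩, ⟨j, hj⟩⟩)
  · exact hc (Sum.inr (⟨φ, hφ⟩, i))

end TypeDefEquiv

end Hyper

/-! ### Strong base change for hyperimaginaries -/

section BaseChange

variable {E : TypeDefEquiv L M ι} {I : Type w} [LinearOrder I] {a : I → ι → M}
  {C D : LowerSet I} {b d : ι → M}

namespace TypeDefEquiv

/-- The pair `(b / E, d / E)` can be moved, fixing the `a i / E` with `i ∈ F`, so that `b / E` and
`d / E` fill the positions of given points `m` and `n` over a finite set `G` of indices. -/
theorem exists_equiv_conjOn_update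
    (ha : IsIndiscernible E.SameType (fun i => E.cls (a i)))
    (hC : IsDedekind C) (hD : IsDedekind D)
    (hb : Fills E.SameType (fun i => E.cls (a i)) C (E.cls b))
    (hd : Fills E.SameType (fun i => E.cls (a i)) D (E.cls d))
    {F G : Finset I} (hFG : F ⊆ G) {t : I} (htF : t ∈ F) (htC : t ∉ C) (htD : t ∈ D) {m n : I}
    (hm : m ∈ gap F C) (hn : n ∈ gap F D) (hmG : m ∉ G) (hnG : n ∉ G) :
    ∃ τ : M ≃[L] M, (∀ i ∈ F, E.toSetoid (τ ∘ a i) (a i)) ∧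
      E.ConjOn ((insert m G : Finset I) : Set I) a (Function.update a m (τ ∘ b)) ∧
      E.ConjOn ((insert n G : Finset I) : Set I) a (Function.update a n (τ ∘ d)) := by
  obtain ⟨e, he, heF, hem, hen⟩ := exists_strictMonoOn_two hC hD htF htC htD G hm hn
  obtain ⟨τ, hτ⟩ := (conjOn_of_strictMonoOn ha he).symm
  have key : ∀ (k : I) (c : ι → M), k ∉ G →
      E.ConjOn ((insert k G : Finset I) : Set I) (fun x => if x = k then c else a (e x))
        (Function.update a k (τ ∘ c)) := fun k c hk => by
    refine ⟨τ, fun x hx => ?_⟩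
    by_cases hxk : x = k
    · subst hxk
      simp
    · simpa [hxk] using hτ x (by simpa [hxk] using hx)
  refine ⟨τ, fun i hi => ?_, (conjOn_of_fills ha hC hb he hmG hem).trans (key m b hmG),
    (conjOn_of_fills ha hD hd he hnG hen).trans (key n d hnG)⟩
  simpa only [heF i hi] using hτ i (hFG hi)

/-- The inductive step of strong base change: a copy of the sequence over `G` is extended either by
a copy of `b` at `m`, or by a copy of `d` at `n`. -/
theorem exists_conjOn_insert
    (ha : IsIndiscernible E.SameType (fun i => E.cls (a i)))
    (hC : IsDedekind C) (hD : IsDedekind D)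
    (hb : Fills E.SameType (fun i => E.cls (a i)) C (E.cls b))
    (hd : Fills E.SameType (fun i => E.cls (a i)) D (E.cls d))
    {F G : Finset I} (hFG : F ⊆ G) {t : I} (htF : t ∈ F) (htC : t ∉ C) (htD : t ∈ D) {m n : I}
    (hm : m ∈ gap F C) (hn : n ∈ gap F D) (hmG : m ∉ G) (hnG : n ∉ G)
    {P₁ P₂ : Set (ι → M)}
    (hbad : ∀ σ : M ≃[L] M, (∀ i ∈ F, E.toSetoid (σ ∘ a i) (a i)) →
      (∀ x, E.toSetoid (σ ∘ b) x → x ∉ P₁) ∨ ∀ x, E.toSetoid (σ ∘ d) x → x ∉ P₂)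
    {γ : I → ι → M} (hγ : E.ConjOn (G : Set I) a γ) (hγF : ∀ i ∈ F, γ i = a i) :
    ∃ c : ι → M,
      (E.ConjOn ((insert m G : Finset I) : Set I) a (Function.update γ m c) ∧
        ∀ x, E.toSetoid c x → x ∉ P₁) ∨
      (E.ConjOn ((insert n G : Finset I) : Set I) a (Function.update γ n c) ∧
        ∀ x, E.toSetoid c x → x ∉ P₂) := by
  obtain ⟨τ, hτF, hτm, hτn⟩ := exists_equiv_conjOn_update ha hC hD hb hd hFG htF htC htD hm hn
    hmG hnG
  obtain ⟨ρ, hρ⟩ := hγ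
  have key : ∀ (k : I) (c : ι → M), k ∉ G →
      E.ConjOn ((insert k G : Finset I) : Set I) (Function.update a k (τ ∘ c))
        (Function.update γ k ((ρ.comp τ) ∘ c)) := fun k c hk => by
    refine ⟨ρ, fun x hx => ?_⟩
    by_cases hxk : x = k
    · subst hxk
      rw [Function.update_self, Function.update_self]
      exact E.toSetoid.refl' _
    · simpa [hxk] using hρ x (by simpa [hxk] using hx)
  rcases hbad (ρ.comp τ) fun i hi => rel_comp_trans (hτF i hi) (by
    simpa only [hγF i hi] using hρ i (hFG hi)) with h | h
  · exact ⟨_, Or.inl ⟨hτm.trans (key m b hmG), h⟩⟩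
  · exact ⟨_, Or.inr ⟨hτn.trans (key n d hnG), h⟩⟩

/-- The induction of strong base change: new terms are inserted one at a time, each being a copy of
`b` outside `P₁` or a copy of `d` outside `P₂`. -/
theorem exists_conjOn_of_forall_bad
    (ha : IsIndiscernible E.SameType (fun i => E.cls (a i)))
    (hC : IsDedekind C) (hD : IsDedekind D)
    (hb : Fills E.SameType (fun i => E.cls (a i)) C (E.cls b))
    (hd : Fills E.SameType (fun i => E.cls (a i)) D (E.cls d))
    {F G₀ : Finset I} (hFG : F ⊆ G₀) {t : I} (htF : t ∈ F) (htC : t ∉ C) (htD : t ∈ D)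
    {P₁ P₂ : Set (ι → M)}
    (hbad : ∀ σ : M ≃[L] M, (∀ i ∈ F, E.toSetoid (σ ∘ a i) (a i)) →
      (∀ x, E.toSetoid (σ ∘ b) x → x ∉ P₁) ∨ ∀ x, E.toSetoid (σ ∘ d) x → x ∉ P₂)
    {m n : ℕ → I} (hm : m.Injective) (hn : n.Injective) (hmC : ∀ j, m j ∈ gap F C)
    (hnD : ∀ j, n j ∈ gap F D) (hmG : ∀ j, m j ∉ G₀) (hnG : ∀ j, n j ∉ G₀) (s : ℕ) :
    ∃ p q, p + q = s ∧ ∃ γ : I → ι → M,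
      E.ConjOn ((G₀ ∪ ((Finset.range p).image m ∪ (Finset.range q).image n) : Finset I) : Set I)
        a γ ∧ (∀ x ∈ G₀, γ x = a x) ∧ (∀ j < p, ∀ x, E.toSetoid (γ (m j)) x → x ∉ P₁) ∧
      ∀ j < q, ∀ x, E.toSetoid (γ (n j)) x → x ∉ P₂ := by
  have hmn : ∀ k l, m k ≠ n l := fun k l =>
    (((hmC k t htF).2 htC).trans ((hnD l t htF).1 htD)).ne
  induction s with
  | zero =>
    exact ⟨0, 0, rfl, a, ⟨.refl L M, fun _ _ => E.toSetoid.refl' _⟩, fun _ _ => rfl,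
      by simp, by simp⟩
  | succ s ih =>
    obtain ⟨p, q, hpq, γ, hγ, hγ₀, h₁, h₂⟩ := ih
    have hmp : m p ∉ G₀ ∪ ((Finset.range p).image m ∪ (Finset.range q).image n) := by
      simp only [Finset.mem_union, Finset.mem_image, Finset.mem_range, not_or, not_exists, not_and]
      exact ⟨hmG p, fun j hj h => hj.ne (hm h), fun j _ h => hmn _ _ h.symm⟩
    have hnq : n q ∉ G₀ ∪ ((Finset.range p).image m ∪ (Finset.range q).image n) := by
      simp only [Finset.mem_union, Finset.mem_image, Finset.mem_range, not_or, not_exists, not_and]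
      exact ⟨hnG q, fun j _ h => hmn _ _ h, fun j hj h => hj.ne (hn h)⟩
    obtain ⟨c, ⟨hc, hcP⟩ | ⟨hc, hcP⟩⟩ := exists_conjOn_insert ha hC hD hb hd
      (hFG.trans Finset.subset_union_left) htF htC htD (hmC p) (hnD q) hmp hnq hbad hγ
      (fun i hi => hγ₀ i (hFG hi))
    · refine ⟨p + 1, q, by omega, Function.update γ (m p) c, ?_, fun x hx => ?_, fun j hj => ?_,
        fun j hj => ?_⟩
      · rwa [Finset.range_add_one, Finset.image_insert, Finset.insert_union,
          Finset.union_insert]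
      · rw [Function.update_of_ne fun h : x = m p => hmG p (h ▸ hx)]
        exact hγ₀ x hx
      · rcases Nat.lt_succ_iff_lt_or_eq.1 hj with hj | rfl
        · rw [Function.update_of_ne fun h => hj.ne (hm h)]
          exact h₁ j hj
        · rw [Function.update_self]
          exact hcP
      · rw [Function.update_of_ne (hmn _ _).symm]
        exact h₂ j hj
    · refine ⟨p, q + 1, by omega, Function.update γ (n q) c, ?_, fun x hx => ?_, fun j hj => ?_,
        fun j hj => ?_⟩
      · rwa [Finset.range_add_one, Finset.image_insert, Finset.union_insert,
          Finset.union_insert]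
      · rw [Function.update_of_ne fun h : x = n q => hnG q (h ▸ hx)]
        exact hγ₀ x hx
      · rw [Function.update_of_ne (hmn _ _)]
        exact h₁ j hj
      · rcases Nat.lt_succ_iff_lt_or_eq.1 hj with hj | rfl
        · rw [Function.update_of_ne fun h => hj.ne (hn h)]
          exact h₂ j hj
        · rw [Function.update_self]
          exact hcP

/-- A copy of `a / E`, in which terms of `P` at the even indices of `z` alternate with classes
disjoint from `P` at the odd indices, comes from an automorphic copy of `a` along which `P`
alternates. -/
theorem exists_alternating_of_conjOn {J : Type*} {G : Set J} {a γ : J → ι → M}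
    (hγ : E.ConjOn G a γ) {P : Set (ι → M)} {z : ℕ → J} {N : ℕ} (hzG : ∀ l < N, z l ∈ G)
    (heven : ∀ l < N, Even l → ∀ x, E.toSetoid (γ (z l)) x → x ∈ P)
    (hodd : ∀ l < N, ¬ Even l → ∀ x, E.toSetoid (γ (z l)) x → x ∉ P) :
    ∃ σ : M ≃[L] M, ∀ l < N, (σ ∘ a (z l) ∈ P ↔ Even l) := by
  obtain ⟨σ, hσ⟩ := hγ
  refine ⟨σ, fun l hl => ?_⟩
  have h := E.toSetoid.symm' (hσ (z l) (hzG l hl))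
  by_cases hl2 : Even l
  · exact iff_of_true (heven l hl hl2 _ h) hl2
  · exact iff_of_false (hodd l hl hl2 _ h) hl2

/-- Strong base change, local form: finitely many conditions satisfied by the terms of the sequence
`a` close to the cuts `C` and `D` are satisfied by representatives of fillers of the cuts. -/
theorem exists_equiv_mem_of_fills [Nonempty M] (hNIP : IsNIP L M) (hM : IsMonster L M κ)
    (hι : #ι < κ) (har : IsIndiscernible (ModelTheory.SameType L) a)
    (hC : IsDedekind C) (hD : IsDedekind D) (hCD : C < D)
    (hb : Fills E.SameType (fun i => E.cls (a i)) C (E.cls b))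
    (hd : Fills E.SameType (fun i => E.cls (a i)) D (E.cls d))
    {A : Set M} (hA : #A < κ) {U₁ U₂ : Set (ι → M)} (hU₁ : A.Definable L U₁)
    (hU₂ : A.Definable L U₂) {ε : Set (ι ⊕ ι → M)} (hε : A.Definable L ε)
    (hEε : ∀ x y, E.toSetoid x y → Sum.elim x y ∈ ε) (F : Finset I)
    (hFU₁ : ∀ k ∈ gap F C, a k ∈ U₁) (hFU₂ : ∀ k ∈ gap F D, a k ∈ U₂) :
    ∃ σ : M ≃[L] M, (∀ i ∈ F, E.toSetoid (σ ∘ a i) (a i)) ∧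
      (∃ x y, E.toSetoid (σ ∘ b) x ∧ Sum.elim x y ∈ ε ∧ y ∈ U₁) ∧
      ∃ x y, E.toSetoid (σ ∘ d) x ∧ Sum.elim x y ∈ ε ∧ y ∈ U₂ := by
  classical
  have ha := isIndiscernible_cls (E := E) hM hι har
  obtain ⟨t, htD, htC⟩ := Set.not_subset.1 hCD.not_ge
  -- The point `t` separates the two gaps.
  let F' := insert t F
  have htF : t ∈ F' := Finset.mem_insert_self _ _
  have hFF : F ⊆ F' := Finset.subset_insert _ _
  -- Members of `P U` meet `U` up to `ε`; the terms of the sequence in the gaps do so together with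
  -- their whole classes.
  let P : Set (ι → M) → Set (ι → M) := fun U => {x | ∃ y, Sum.elim x y ∈ ε ∧ y ∈ U}
  have hPdef : ∀ U, A.Definable L U → A.Definable L (P U) := fun U hU =>
    definable_exists (hε.inter (hU.preimage_comp Sum.inr))
  have hP₁ : ∀ k ∈ gap F' C, ∀ x, E.toSetoid (a k) x → x ∈ P U₁ := fun k hk x hx =>
    ⟨a k, hEε _ _ (E.toSetoid.symm' hx), hFU₁ k (gap_mono hFF hk)⟩
  have hP₂ : ∀ k ∈ gap F' D, ∀ x, E.toSetoid (a k) x → x ∈ P U₂ := fun k hk x hx =>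
    ⟨a k, hEε _ _ (E.toSetoid.symm' hx), hFU₂ k (gap_mono hFF hk)⟩
  by_contra hcon
  have hbad : ∀ σ : M ≃[L] M, (∀ i ∈ F', E.toSetoid (σ ∘ a i) (a i)) →
      (∀ x, E.toSetoid (σ ∘ b) x → x ∉ P U₁) ∨ ∀ x, E.toSetoid (σ ∘ d) x → x ∉ P U₂ := by
    intro σ hσ
    by_contra! h
    obtain ⟨⟨x, hx, y, hy⟩, x', hx', y', hy'⟩ := h
    exact hcon ⟨σ, fun i hi => hσ i (hFF hi), ⟨x, y, hx, hy⟩, x', y', hx', hy'⟩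
  have hseq : ∀ {B : LowerSet I}, IsDedekind B →
      ∃ z : ℕ → I, StrictMono z ∧ ∀ k, z k ∈ gap F' B := fun {B} hB => by
    have h := hB.gap_left F'
    have : Nonempty ↥(gap F' B ∩ (B : Set I)) := h.1.to_subtype
    have : NoMaxOrder ↥(gap F' B ∩ (B : Set I)) := ⟨fun x => by
      obtain ⟨y, hy, hxy⟩ := h.2 x x.2
      exact ⟨⟨y, hy⟩, hxy⟩⟩
    obtain ⟨z, hz⟩ := Nat.exists_strictMono ↥(gap F' B ∩ (B : Set I))
    exact ⟨fun k => z k, hz, fun k => (z k).2.1⟩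
  obtain ⟨z, hz, hzC⟩ := hseq hC
  obtain ⟨w, hw, hwD⟩ := hseq hD
  have hzw : ∀ k l, z k ≠ w l := fun k l =>
    (((hzC k t htF).2 htC).trans ((hwD l t htF).1 htD)).ne
  obtain ⟨N₁, hN₁⟩ := hNIP.exists_forall_not_alternating hM hι hA (hPdef _ hU₁) har hz
  obtain ⟨N₂, hN₂⟩ := hNIP.exists_forall_not_alternating hM hι hA (hPdef _ hU₂) har hw
  let N := max N₁ N₂
  -- The terms of the sequence at the even indices of `z` and `w` are kept, and new terms are inserted
  -- at the odd indices.
  let G₀ : Finset I := F' ∪ ((Finset.range N).image (fun j => z (2 * j)) ∪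
    (Finset.range N).image (fun j => w (2 * j)))
  let G : ℕ → ℕ → Finset I := fun p q => G₀ ∪ ((Finset.range p).image (fun j => z (2 * j + 1)) ∪
    (Finset.range q).image (fun j => w (2 * j + 1)))
  have hmemG : ∀ p q x, x ∈ G p q ↔ x ∈ G₀ ∨ (∃ j < p, z (2 * j + 1) = x) ∨
      ∃ j < q, w (2 * j + 1) = x := fun p q x => by simp [G]
  have hFG₀ : F' ⊆ G₀ := Finset.subset_union_left
  have hG₀G : ∀ p q, G₀ ⊆ G p q := fun p q => Finset.subset_union_left
  have hzG₀ : ∀ j, z (2 * j + 1) ∉ G₀ := fun j hj => by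
    simp only [G₀, Finset.mem_union, Finset.mem_image] at hj
    rcases hj with h | ⟨i, -, h⟩ | ⟨i, -, h⟩
    · exact notMem_of_mem_gap (hzC _) h
    · have := hz.injective h
      omega
    · exact hzw _ _ h.symm
  have hwG₀ : ∀ j, w (2 * j + 1) ∉ G₀ := fun j hj => by
    simp only [G₀, Finset.mem_union, Finset.mem_image] at hj
    rcases hj with h | ⟨i, -, h⟩ | ⟨i, -, h⟩
    · exact notMem_of_mem_gap (hwD _) h
    · exact hzw _ _ h
    · have := hw.injective h
      omega
  -- Half of the inserted terms fill the same gap, and `P U₁` or `P U₂` alternates too often.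
  obtain ⟨p, q, hpq, γ, hγ, hγ₀, h₁, h₂⟩ :=
    exists_conjOn_of_forall_bad ha hC hD hb hd hFG₀ htF htC htD hbad
      (m := fun j => z (2 * j + 1)) (n := fun j => w (2 * j + 1))
      (fun i j h => by have := hz.injective h; omega)
      (fun i j h => by have := hw.injective h; omega)
      (fun _ => hzC _) (fun _ => hwD _) hzG₀ hwG₀ (2 * N)
  have hNN₁ : N₁ ≤ N := le_max_left _ _
  have hNN₂ : N₂ ≤ N := le_max_right _ _
  rcases (by omega : N ≤ p ∨ N ≤ q) with hp | hq
  · have hzG₀' : ∀ j < N, z (2 * j) ∈ G₀ := fun j hj => Finset.mem_union_right _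
      (Finset.mem_union_left _ (Finset.mem_image.2 ⟨j, Finset.mem_range.2 hj, rfl⟩))
    obtain ⟨σ, hσ⟩ := exists_alternating_of_conjOn (N := N₁) (z := z) (P := P U₁) hγ
      (fun l hl => by
        rcases Nat.even_or_odd' l with ⟨j, rfl | rfl⟩
        · exact hG₀G p q (hzG₀' j (by omega))
        · exact (hmemG _ _ _).2 (Or.inr (Or.inl ⟨j, by omega, rfl⟩)))
      (fun l hl hl2 => by
        obtain ⟨j, rfl⟩ := even_iff_exists_two_mul.1 hl2
        rw [hγ₀ _ (hzG₀' j (by omega))]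
        exact hP₁ _ (hzC _))
      (fun l hl hl2 => by
        obtain ⟨j, rfl⟩ := Nat.not_even_iff_odd.1 hl2
        exact h₁ j (by omega))
    exact hN₁ σ hσ
  · have hwG₀' : ∀ j < N, w (2 * j) ∈ G₀ := fun j hj => Finset.mem_union_right _
      (Finset.mem_union_right _ (Finset.mem_image.2 ⟨j, Finset.mem_range.2 hj, rfl⟩))
    obtain ⟨σ, hσ⟩ := exists_alternating_of_conjOn (N := N₂) (z := w) (P := P U₂) hγ
      (fun l hl => by
        rcases Nat.even_or_odd' l with ⟨j, rfl | rfl⟩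
        · exact hG₀G p q (hwG₀' j (by omega))
        · exact (hmemG _ _ _).2 (Or.inr (Or.inr ⟨j, by omega, rfl⟩)))
      (fun l hl hl2 => by
        obtain ⟨j, rfl⟩ := even_iff_exists_two_mul.1 hl2
        rw [hγ₀ _ (hwG₀' j (by omega))]
        exact hP₂ _ (hwD _))
      (fun l hl hl2 => by
        obtain ⟨j, rfl⟩ := Nat.not_even_iff_odd.1 hl2
        exact h₂ j (by omega))
    exact hN₂ σ hσ

end TypeDefEquiv

end BaseChange

/-! ### The index order of a filled cut -/

section Slot

variable {I : Type w} [LinearOrder I]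

/-- The term of index `x` of `I₁ + b + I₂` is `b` if `slot C x = none`, and is the term of index `i`
of the original sequence if `slot C x = some i`. -/
def slot (C : LowerSet I) :
    ((C : Set I) ⊕ₗ PUnit.{w + 1}) ⊕ₗ ((C : Set I)ᶜ : Set I) → Option I := fun x =>
  Sum.elim (fun y => Sum.elim (fun i => some i.1) (fun _ => none) (ofLex y))
    (fun i => some i.1) (ofLex x)

theorem concat_eq_slot {X : Type*} (a : I → X) (C : LowerSet I) (b : X) :
    concat (concat (part a (C : Set I)) (single.{w} b)) (part a (C : Set I)ᶜ) =
      fun x => (slot C x).elim b a := by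
  funext x
  rcases x with (x | x) | x <;> rfl

/-- Placing an element of the gap of `C` at the new index respects the order. -/
theorem slot_getD_lt {C : LowerSet I} {F : Finset I} {k : I} (hk : k ∈ gap F C)
    {x y : ((C : Set I) ⊕ₗ PUnit.{w + 1}) ⊕ₗ ((C : Set I)ᶜ : Set I)} (hxy : x < y)
    (hx : ∀ i, slot C x = some i → i ∈ F) (hy : ∀ i, slot C y = some i → i ∈ F) :
    (slot C x).getD k < (slot C y).getD k := by
  have hlt : ∀ i j : I, i ∈ C → j ∉ C → i < j := fun i j hi hj =>
    lt_of_not_ge fun hle => hj (C.lower hle hi)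
  rcases x with (x | x) | x <;> rcases y with (y | y) | y
  · have h : x < y := Sum.Lex.inl_lt_inl_iff.1 (Sum.Lex.inl_lt_inl_iff.1 hxy)
    exact h
  · exact (hk _ (hx _ rfl)).1 x.2
  · exact hlt _ _ x.2 y.2
  · exact absurd (Sum.Lex.inl_lt_inl_iff.1 hxy) Sum.Lex.not_inr_lt_inl
  · exact absurd (Sum.Lex.inr_lt_inr_iff.1 (Sum.Lex.inl_lt_inl_iff.1 hxy)) (lt_irrefl _)
  · exact (hk _ (hy _ rfl)).2 y.2
  · exact absurd hxy Sum.Lex.not_inr_lt_inl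
  · exact absurd hxy Sum.Lex.not_inr_lt_inl
  · have h : x < y := Sum.Lex.inr_lt_inr_iff.1 hxy
    exact h

theorem exists_strictMono_slot (C : LowerSet I) :
    ∃ f : I → ((C : Set I) ⊕ₗ PUnit.{w + 1}) ⊕ₗ ((C : Set I)ᶜ : Set I),
      StrictMono f ∧ ∀ i, slot C (f i) = some i := by
  classical
  refine ⟨fun i => if h : i ∈ C then toLex (Sum.inl (toLex (Sum.inl ⟨i, h⟩)))
    else toLex (Sum.inr ⟨i, h⟩), fun i j hij => ?_, fun i => ?_⟩
  · by_cases hi : i ∈ C <;> by_cases hj : j ∈ C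
    · simpa [hi, hj] using hij
    · simp [hi, hj]
    · exact absurd (C.lower hij.le hj) hi
    · simpa [hi, hj] using hij
  · by_cases hi : i ∈ C <;> simp [hi, slot]

end Slot

/-! ### Representatives of fillers -/

section Fillers

variable {E : TypeDefEquiv L M ι} {I : Type w} [LinearOrder I] {a : I → ι → M}

/-- `I₁ + b + I₂` is indiscernible, where `(I₁, I₂)` is the cut `C` of `a'`, with the same
types of increasing tuples as the sequence `a`. -/
def FillsLike (L : FirstOrder.Language.{u, v}) [L.Structure M] (a a' : I → ι → M)
    (C : LowerSet I) (b : ι → M) : Prop :=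
  ∀ (n : ℕ) (f : Fin n → ((C : Set I) ⊕ₗ PUnit.{w + 1}) ⊕ₗ ((C : Set I)ᶜ : Set I))
    (j : Fin n → I), StrictMono f → StrictMono j →
      SameType L n (fun k => a (j k)) (fun k => (slot C (f k)).elim b a')

theorem FillsLike.sameType {a' : I → ι → M} {C : LowerSet I} {b : ι → M}
    (h : FillsLike L a a' C b) {n : ℕ} {i : Fin n → I} (hi : StrictMono i) :
    SameType L n (fun k => a (i k)) (fun k => a' (i k)) := by
  obtain ⟨f, hf, hfs⟩ := exists_strictMono_slot C
  simpa [hfs] using h n (fun k => f (i k)) i (hf.comp hi) hi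

theorem FillsLike.fills {a' : I → ι → M} {C : LowerSet I} {b : ι → M} (hC : IsDedekind C)
    (h : FillsLike L a a' C b) : Fills (SameType L) a' C b := fun n f g hf hg => by
  have : Infinite I := hC.infinite
  obtain ⟨t, ht⟩ := Infinite.exists_subset_card_eq I n
  have hj := (t.orderEmbOfFin ht).strictMono
  rw [concat_eq_slot]
  exact (h n f _ hf hj).symm.trans (h n g _ hg hj)

theorem Fills.comp (σ : M ≃[L] M) {a' : I → ι → M} {C : LowerSet I} {b : ι → M}
    (h : Fills (SameType L) a' C b) :
    Fills (SameType L) (fun i => (σ ∘ a' i : ι → M)) C (σ ∘ b) := by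
  unfold Fills at h ⊢
  have := isIndiscernible_comp σ h
  rw [concat_eq_slot] at this ⊢
  convert this using 2 with x
  cases hs : slot C x <;> simp [hs]

/-- The data of one of the conditions that make up `FillsLike`: the formula `χ` should hold of
the terms of `I₁ + b + I₂` with indices `f` if it holds of the terms of `a` with indices `j`. -/
structure FillCondition (L : FirstOrder.Language.{u, v}) (ι : Type w) {I : Type w} [LinearOrder I]
    (C : LowerSet I) where
  n : ℕ
  χ : L.Formula (Fin n × ι)
  f : Fin n → ((C : Set I) ⊕ₗ PUnit.{w + 1}) ⊕ₗ ((C : Set I)ᶜ : Set I)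
  j : Fin n → I
  strictMono_f : StrictMono f
  strictMono_j : StrictMono j

namespace FillCondition

variable {C : LowerSet I}

/-- The condition holds for the filler `b` of the cut of `a'`. -/
def Holds (q : FillCondition L ι C) (a a' : I → ι → M) (b : ι → M) : Prop :=
  q.χ.Realize (fun p => a (q.j p.1) p.2) →
    q.χ.Realize (fun p => (slot C (q.f p.1)).elim b a' p.2)

theorem fillsLike {a' : I → ι → M} {b : ι → M}
    (h : ∀ q : FillCondition L ι C, q.Holds a a' b) : FillsLike L a a' C b :=
  fun n f j hf hj χ => by
    refine ⟨h ⟨n, χ, f, j, hf, hj⟩, fun hr => ?_⟩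
    by_contra hn
    exact h ⟨n, χ.not, f, j, hf, hj⟩ (by simpa using hn) hr

open Classical in
/-- The indices of the terms of the sequence that are mentioned in the condition. -/
noncomputable def support (q : FillCondition L ι C) : Finset I :=
  Finset.univ.biUnion fun k => (slot C (q.f k)).toFinset

theorem mem_support {q : FillCondition L ι C} {k : Fin q.n} {i : I}
    (h : slot C (q.f k) = some i) : i ∈ q.support := by
  classical
  exact Finset.mem_biUnion.2 ⟨k, Finset.mem_univ k, by simp [h]⟩

theorem holds_of_mem_gap (q : FillCondition L ι C) (ha : IsIndiscernible (SameType L) a)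
    {F : Finset I} (hF : q.support ⊆ F) {k : I} (hk : k ∈ gap F C) : q.Holds a a (a k) := by
  intro h
  have hsm : StrictMono fun l => (slot C (q.f l)).getD k := fun l l' hl =>
    slot_getD_lt hk (q.strictMono_f hl) (fun i hi => hF (mem_support hi))
      fun i hi => hF (mem_support hi)
  convert (ha q.n q.j _ q.strictMono_j hsm q.χ).1 h using 2 with p
  cases hs : slot C (q.f p.1) <;> simp [hs]

theorem holds_comp (q : FillCondition L ι C) (σ : M ≃[L] M) {a' : I → ι → M} {b : ι → M} :
    q.Holds a (fun i => σ ∘ a' i) (σ ∘ b) ↔ q.Holds a a' b := by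
  have : (fun p : Fin q.n × ι => (slot C (q.f p.1)).elim (σ ∘ b) (fun i => σ ∘ a' i) p.2) =
      σ ∘ fun p => (slot C (q.f p.1)).elim b a' p.2 := by
    funext p
    cases hs : slot C (q.f p.1) <;> simp [hs]
  rw [Holds, Holds, this, Language.StrongHomClass.realize_formula σ]

theorem definable_holds (q : FillCondition L ι C) {A : Set M} {V : Type*}
    {a' : (V → M) → I → ι → M} {b : (V → M) → ι → M}
    (ha' : ∀ i t, (∃ x, ∀ c, a' c i t = c x) ∨ ∃ m ∈ A, ∀ c, a' c i t = m)
    (hb : ∀ t, (∃ x, ∀ c, b c t = c x) ∨ ∃ m ∈ A, ∀ c, b c t = m) :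
    A.Definable L {c | q.Holds a (a' c) (b c)} := by
  by_cases h : q.χ.Realize (fun p => a (q.j p.1) p.2)
  · simp only [Holds, h, true_imp_iff]
    refine definable_realize q.χ
      (fun c (p : Fin q.n × ι) => (slot C (q.f p.1)).elim (b c) (a' c) p.2) fun p => ?_
    cases slot C (q.f p.1) with
    | none => exact hb p.2
    | some i => exact ha' i p.2
  · simp [Holds, h]

end FillCondition

namespace TypeDefEquiv

/-- Strong base change: fillers of two cuts of a sequence of hyperimaginaries have representatives
that fill the same cuts of one and the same indiscernible sequence of representatives. -/
theorem exists_fillsLike [Nonempty M] (hNIP : IsNIP L M) (hM : IsMonster L M κ) (hι : #ι < κ)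
    (hI : #I < κ) (ha : IsIndiscernible (ModelTheory.SameType L) a) {C D : LowerSet I}
    (hC : IsDedekind C) (hD : IsDedekind D) (hCD : C < D) {b d : ι → M}
    (hb : Fills E.SameType (fun i => E.cls (a i)) C (E.cls b))
    (hd : Fills E.SameType (fun i => E.cls (a i)) D (E.cls d)) :
    ∃ (a' : I → ι → M) (b' d' : ι → M), (∀ i, E.toSetoid (a' i) (a i)) ∧ E.toSetoid b b' ∧
      E.toSetoid d d' ∧ FillsLike L a a' C b' ∧ FillsLike L a a' D d' := by
  classical
  obtain ⟨Φ, hΦ⟩ := E.typeDefinable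
  have hcard : #((I ⊕ ULift.{w} (Bool × Bool)) × ι) < κ := by
    have h4 : #(I ⊕ ULift.{w} (Bool × Bool)) < κ := by
      rw [Cardinal.mk_sum]
      refine Cardinal.add_lt_of_lt hM.aleph0_lt.le (by simpa) ?_
      simpa using (Cardinal.lt_aleph0_of_finite (ULift.{w} (Bool × Bool))).trans hM.aleph0_lt
    rw [Cardinal.mk_prod]
    refine Cardinal.mul_lt_of_lt hM.aleph0_lt.le ?_ ?_
    · rwa [Cardinal.lift_id]
    · rwa [Cardinal.lift_id]
  let f : Bool → ι → M := fun s => cond s d b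
  let A : Set M := Set.range fun p : (I ⊕ ULift.{w} (Bool × Bool)) × ι =>
    Sum.elim a (fun k => f k.down.2) p.1 p.2
  have hA : #A < κ := Cardinal.mk_range_le.trans_lt hcard
  have haA : ∀ i t, a i t ∈ A := fun i t => ⟨(Sum.inl i, t), rfl⟩
  have hfA : ∀ s t, f s t ∈ A := fun s t => ⟨(Sum.inr ⟨true, s⟩, t), rfl⟩
  -- The variables `a'`, and for each of the two fillers `f s` an equivalent tuple `x false s` and a
  -- tuple `x true s` equivalent to `x false s`. The intermediate tuple `x false s` is there because
  -- the local form of strong base change gives two equivalences, the second only approximately.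
  let a' : ((I ⊕ ULift.{w} (Bool × Bool)) × ι → M) → I → ι → M := fun c i t => c (Sum.inl i, t)
  let x : Bool → Bool → ((I ⊕ ULift.{w} (Bool × Bool)) × ι → M) → ι → M := fun k s c t =>
    c (Sum.inr ⟨k, s⟩, t)
  let R : I ⊕ Bool × Bool → ((I ⊕ ULift.{w} (Bool × Bool)) × ι → M) → ι ⊕ ι → M := fun r c =>
    match r with
    | Sum.inl i => Sum.elim (a' c i) (a i)
    | Sum.inr (false, s) => Sum.elim (f s) (x false s c)
    | Sum.inr (true, s) => Sum.elim (x false s c) (x true s c)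
  obtain ⟨c, hc⟩ := hM.isSaturated.exists_forall_mem hA hcard
    (J := (Φ × (I ⊕ Bool × Bool)) ⊕ (FillCondition L ι C ⊕ FillCondition L ι D))
    (Q := Sum.elim (fun q => {c | q.1.1.Realize (R q.2 c)})
      (Sum.elim (fun q => {c | q.Holds a (a' c) (x true false c)})
        (fun q => {c | q.Holds a (a' c) (x true true c)})))
    (by
      have hx : ∀ k s t, (∃ y, ∀ c, x k s c t = c y) ∨ ∃ m ∈ A, ∀ c, x k s c t = m :=
        fun k s t => Or.inl ⟨_, fun _ => rfl⟩
      rintro (⟨φ, r⟩ | q | q)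
      · refine definable_realize _ (R r) ?_
        rcases r with i | ⟨_ | _, s⟩ <;> rintro (t | t)
        · exact Or.inl ⟨_, fun _ => rfl⟩
        · exact Or.inr ⟨_, haA i t, fun _ => rfl⟩
        · exact Or.inr ⟨_, hfA s t, fun _ => rfl⟩
        · exact hx _ _ t
        · exact hx _ _ t
        · exact hx _ _ t
      · exact q.definable_holds (fun i t => Or.inl ⟨_, fun _ => rfl⟩) (hx _ _)
      · exact q.definable_holds (fun i t => Or.inl ⟨_, fun _ => rfl⟩) (hx _ _))
    (fun S => by
      let F : Finset I := (S.toLeft.image Prod.snd).toLeft ∪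
        (S.toRight.toLeft.biUnion FillCondition.support ∪
          S.toRight.toRight.biUnion FillCondition.support)
      have hU : ∀ {B : LowerSet I} (T : Finset (FillCondition L ι B)),
          A.Definable L {y | ∀ q ∈ T, q.Holds a a y} := fun T => by
        have := Set.definable_biInter_finset (L := L) (A := A)
          (fun q : FillCondition L ι _ => q.definable_holds (a := a) (A := A)
            (a' := fun (c : ι → M) => a) (b := fun c => c)
            (fun i t => Or.inr ⟨_, haA i t, fun _ => rfl⟩)
            (fun t => Or.inl ⟨t, fun _ => rfl⟩)) T
        convert this using 1
        ext y
        simp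
      have hε : A.Definable L {y : ι ⊕ ι → M | ∀ φ ∈ S.toLeft.image Prod.fst, φ.1.Realize y} := by
        have := Set.definable_biInter_finset (L := L) (A := A)
          (fun φ : Φ => definable_realize (A := A) φ.1 (fun c : ι ⊕ ι → M => c)
            (fun t => Or.inl ⟨t, fun _ => rfl⟩)) (S.toLeft.image Prod.fst)
        convert this using 1
        ext y
        simp
      obtain ⟨σ, hσ, ⟨y₀, y₁, hy₀, hy, hy₁⟩, z₀, z₁, hz₀, hz, hz₁⟩ :=
        exists_equiv_mem_of_fills hNIP hM hι ha hC hD hCD hb hd hA (hU S.toRight.toLeft)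
          (hU S.toRight.toRight) hε (fun u v huv φ _ => (hΦ u v).1 huv φ.1 φ.2) F
          (fun k hk q hq => q.holds_of_mem_gap ha ((Finset.subset_biUnion_of_mem _ hq).trans
            (Finset.subset_union_left.trans Finset.subset_union_right)) hk)
          (fun k hk q hq => q.holds_of_mem_gap ha ((Finset.subset_biUnion_of_mem _ hq).trans
            (Finset.subset_union_right.trans Finset.subset_union_right)) hk)
      let g : I ⊕ ULift.{w} (Bool × Bool) → ι → M := Sum.elim a fun k =>
        cond k.down.1 (cond k.down.2 z₁ y₁) (cond k.down.2 z₀ y₀)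
      refine ⟨fun p => σ.symm (g p.1 p.2), ?_⟩
      rintro (⟨φ, r⟩ | q | q) hq
      · have hΔ : φ ∈ S.toLeft.image Prod.fst :=
          Finset.mem_image.2 ⟨_, Finset.mem_toLeft.2 hq, rfl⟩
        have hmap : ∀ u v : ι → M, φ.1.Realize (Sum.elim u v) →
            φ.1.Realize (Sum.elim (σ.symm ∘ u) (σ.symm ∘ v)) := fun u v h => by
          rw [← Sum.comp_elim]
          exact (Language.StrongHomClass.realize_formula σ.symm φ.1).2 h
        rcases r with i | ⟨_ | _, _ | _⟩
        · exact (hΦ _ _).1 (rel_symm_comp (hσ i (Finset.mem_union_left _ (Finset.mem_toLeft.2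
            (Finset.mem_image.2 ⟨_, Finset.mem_toLeft.2 hq, rfl⟩))))) φ.1 φ.2
        · exact (hΦ _ _).1 (E.toSetoid.symm' (rel_symm_comp hy₀)) φ.1 φ.2
        · exact (hΦ _ _).1 (E.toSetoid.symm' (rel_symm_comp hz₀)) φ.1 φ.2
        · exact hmap _ _ (hy φ hΔ)
        · exact hmap _ _ (hz φ hΔ)
      · exact (q.holds_comp σ.symm).2
          (hy₁ q (Finset.mem_toLeft.2 (Finset.mem_toRight.2 hq)))
      · exact (q.holds_comp σ.symm).2
          (hz₁ q (Finset.mem_toRight.2 (Finset.mem_toRight.2 hq))))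
  have hR : ∀ s, E.toSetoid (f s) (x true s c) := fun s =>
    E.toSetoid.trans' ((hΦ _ _).2 fun φ hφ => hc (Sum.inl (⟨φ, hφ⟩, Sum.inr (false, s))))
      ((hΦ _ _).2 fun φ hφ => hc (Sum.inl (⟨φ, hφ⟩, Sum.inr (true, s))))
  exact ⟨a' c, x true false c, x true true c,
    fun i => (hΦ _ _).2 fun φ hφ => hc (Sum.inl (⟨φ, hφ⟩, Sum.inl i)), hR false, hR true,
    FillCondition.fillsLike fun q => hc (Sum.inr (Sum.inl q)),
    FillCondition.fillsLike fun q => hc (Sum.inr (Sum.inr q))⟩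

end TypeDefEquiv

end Fillers

/-! ### Preservation of distality -/

theorem isDistalSeq_of_finite {X : Type w'} {S : ∀ n : ℕ, (Fin n → X) → (Fin n → X) → Prop}
    {I : Type w} [LinearOrder I] [Finite I] {a : I → X} (ha : IsIndiscernible S a) :
    IsDistalSeq S a :=
  ⟨ha, fun _ _ hC => absurd hC.infinite (not_infinite_iff_finite.2 inferInstance)⟩

/-- The sequence of hyperimaginaries given by a distal sequence of tuples is distal. -/
theorem IsDistalSeq.cls [Nonempty M] (hNIP : IsNIP L M) (hM : IsMonster L M κ) (hι : #ι < κ)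
    (E : TypeDefEquiv L M ι) {I : Type w} [LinearOrder I] (hI : #I < κ) {a : I → ι → M}
    (ha : IsDistalSeq (SameType L) a) : IsDistalSeq E.SameType (fun i => E.cls (a i)) := by
  refine ⟨E.isIndiscernible_cls hM hι ha.1, fun C D hC hD hCD β δ hβ hδ => ?_⟩
  obtain ⟨b, rfl⟩ : ∃ b, E.cls b = β := Quotient.exists_rep β
  obtain ⟨d, rfl⟩ : ∃ d, E.cls d = δ := Quotient.exists_rep δ
  obtain ⟨a', b', d', haa', hbb', hdd', hb', hd'⟩ :=
    TypeDefEquiv.exists_fillsLike hNIP hM hι hI ha.1 hC hD hCD hβ hδ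
  obtain ⟨σ, hσ⟩ := exists_equiv_of_forall_sameType hM hι hI fun n i hi =>
    (hb'.sameType hi).symm
  have hσ' : ∀ x : ι → M, (σ.symm : M → M) ∘ (σ ∘ x) = x := fun x =>
    funext fun t => σ.symm_apply_apply _
  have hσa : ∀ i, (σ.symm : M → M) ∘ a i = a' i := fun i => by rw [← hσ, hσ']
  have hbC := Fills.comp σ (hb'.fills hC)
  have hdD := Fills.comp σ (hd'.fills hD)
  simp only [hσ] at hbC hdD
  -- Distality is applied to `a`, and the resulting sequence is moved back to `a'`.
  have key := TypeDefEquiv.isIndiscernible_cls (E := E) hM hι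
    (isIndiscernible_comp σ.symm (ha.2 C D hC hD hCD _ _ hbC hdD))
  convert key using 2 with x
  rcases x with (((x | x) | x) | x) | x
  · exact Quotient.sound (show E.toSetoid (a x) (σ.symm ∘ a x) by
      rw [hσa]; exact E.toSetoid.symm' (haa' x))
  · exact Quotient.sound (show E.toSetoid b (σ.symm ∘ (σ ∘ b')) by rwa [hσ'])
  · exact Quotient.sound (show E.toSetoid (a x) (σ.symm ∘ a x) by
      rw [hσa]; exact E.toSetoid.symm' (haa' x))
  · exact Quotient.sound (show E.toSetoid d (σ.symm ∘ (σ ∘ d')) by rwa [hσ'])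
  · exact Quotient.sound (show E.toSetoid (a x) (σ.symm ∘ a x) by
      rw [hσa]; exact E.toSetoid.symm' (haa' x))

/-- If `T` is distal, then so is `T^heq`: an infinite indiscernible sequence of hyperimaginaries is
the image of an indiscernible, hence distal, sequence of representatives. -/
theorem IsDistal.isHeqDistal [Nonempty M] (hNIP : IsNIP L M) (hM : IsMonster L M κ)
    (h : IsDistal L M κ) : IsHeqDistal L M κ := by
  intro ι hι E I _ _ hI α hα
  rcases finite_or_infinite I with _ | _
  · exact isDistalSeq_of_finite hα
  obtain ⟨a, rfl⟩ : ∃ a : I → ι → M, (fun i => E.cls (a i)) = α :=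
    ⟨fun i => (α i).out, funext fun i => Quotient.out_eq _⟩
  obtain ⟨c, hc, hca⟩ := TypeDefEquiv.exists_isIndiscernible_lift hM hι hI hα
  have hcls : (fun i => E.cls (c i)) = fun i => E.cls (a i) :=
    funext fun i => Quotient.sound (hca i)
  rw [← hcls]
  exact IsDistalSeq.cls hNIP hM hι E hI (h ι hι I hI c hc)

end ModelTheory

theorem mainTheorem2 {L : FirstOrder.Language.{u, v}} (T : L.Theory) (_hT : T.IsComplete)
    (M : Type w) [L.Structure M] [Nonempty M] [_hMT : M ⊨ T]
    (κ : Cardinal.{w}) (_hM : ModelTheory.IsMonster L M κ) (_hNIP : ModelTheory.IsNIP L M) :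
    (∀ (ι : Type w), #ι < κ → ∀ (E : ModelTheory.TypeDefEquiv L M ι),
      ∀ (I : Type w) [LinearOrder I] [DenselyOrdered I], #I < κ →
        ∀ a : I → ι → M, ModelTheory.IsDistalSeq (ModelTheory.SameType L) a →
          ModelTheory.IsDistalSeq E.SameType (fun i => E.cls (a i))) ∧
    (ModelTheory.IsDistal L M κ → ModelTheory.IsHeqDistal L M κ) :=
  ⟨fun _ hι E _ _ _ hI _ ha => ha.cls _hNIP _hM hι E hI,
    fun h => h.isHeqDistal _hNIP _hM⟩
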